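/- Let $\mathbb{K}=\mathbb{R}$ or $\mathbb{C}$ and $d\ge 2$. For $g\in \mathsf{GL}_d(\mathbb{K})$ let $\sigma_1(g)\ge\dots\ge\sigma_d(g)$ be the singular values and $\ell_1(g)\ge\dots\ge\ell_d(g)$ the moduli of the (complex) eigenvalues of $g$, counted with multiplicity; write $\frac{\sigma_1}{\sigma_2}(g)=\frac{\sigma_1(g)}{\sigma_2(g)}$ and $\frac{\ell_1}{\ell_2}(g)=\frac{\ell_1(g)}{\ell_2(g)}$. A semigroup $\Gamma\subset\mathsf{GL}_d(\mathbb{K})$ is *$1$-divergent* if $\frac{\sigma_1}{\sigma_2}(\gamma_n)\to\infty$ for every sequence $(\gamma_n)$ of pairwise distinct elements of $\Gamma$. Let $\Gamma_1,\Gamma_2\subset\mathsf{GL}_d(\mathbb{K})$ be semigroups, and let $U_1,U_2\subset\mathbb{P}(\mathbb{K}^d)$ and $V_1,V_2\subset\mathsf{Gr}_{d-1}(\mathbb{K}^d)$ be nonempty open subsets. A point $[v]\in\mathbb{P}(\mathbb{K}^d)$ and a hyperplane $W\in\mathsf{Gr}_{d-1}(\mathbb{K}^d)$ are *transverse* if $v\notin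 W$. We say that $\Gamma_1,\Gamma_2$ are *in ping-pong position relative to* $U_1,U_2$ and $V_1,V_2$ if, whenever $\{i,j\}=\{1,2\}$: (1) every point of $\overline{U_i}$ is transverse to every hyperplane of $\overline{V_j}$; (2) for every $\gamma\in\Gamma_i\smallsetminus\{I_d\}$ we have $\gamma\overline{U_j}\subset U_i$ and $\gamma^{-1}\overline{V_j}\subset V_i$. A *reduced word* is an expression $\gamma_1\cdots\gamma_n$ with $n\ge 2$ whose letters satisfy $\gamma_k\in\Gamma_{s_k}\smallsetminus\{I_d\}$ for some indices $s_1,\dots,s_n\in\{1,2\}$ with $s_k\ne s_{k+1}$ for $1\le k<n$ (that is, the letters are nontrivial and are taken alternately from the two semigroups). **Theorem.** Suppose that $\Gamma_1,\Gamma_2\subset\mathsf{GL}_d(\mathbb{K})$ are $1$-divergent semigroups in ping-pong position relative to nonempty open subsets $U_1,U_2\subset\mathbb{P}(\mathbb{K}^d)$ and $V_1,V_2\subset\mathsf{Gr}_{d-1}(\mathbb{K}^d)$. Then: (i) There exist $C_1>0$ and $\lambda>1$ such that for every reduced word $\gamma_1\cdots\gamma_n$, $$\frac{\sigma_1}{\sigma_2}(\gamma_1\cdots\gamma_n)\ge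 C_1\lambda^n.$$ (ii) There exists $C_2>0$ such that for every reduced word $\gamma_1\cdots\gamma_n$, $$\sigma_1(\gamma_1\cdots\gamma_n)\ge C_2^n\,\sigma_1(\gamma_1)\cdots\sigma_1(\gamma_n).$$ (iii) There exists $C_3>0$ such that for every reduced word $\gamma_1\cdots\gamma_n$, $$\frac{\sigma_1}{\sigma_2}(\gamma_1\cdots\gamma_n)\ge C_3^n\,\frac{\sigma_1}{\sigma_2}(\gamma_1)\cdots\frac{\sigma_1}{\sigma_2}(\gamma_n).$$ (iv) There exists $C_4>0$ such that for every even $n$ and every reduced word $\gamma_1\cdots\gamma_n$, $$\frac{\ell_1}{\ell_2}(\gamma_1\cdots\gamma_n)\ge C_4^n\,\frac{\sigma_1}{\sigma_2}(\gamma_1)\cdots\frac{\sigma_1}{\sigma_2}(\gamma_n).$$ -/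

import Mathlib

open Filter Topology
open scoped LinearAlgebra.Projectivization MatrixGroups

noncomputable section

namespace PingPong

variable {𝕜 : Type*} [RCLike 𝕜] {d : ℕ}

/-! ### Projective space, the space of hyperplanes, and the action of `GL_d(𝕜)` -/

/-- The projective space of `𝕜^d`, with the quotient topology from the nonzero vectors. -/
instance instTopologicalSpaceProj : TopologicalSpace (ℙ 𝕜 (EuclideanSpace 𝕜 (Fin d))) :=
  TopologicalSpace.coinduced
    (fun v : {v : EuclideanSpace 𝕜 (Fin d) // v ≠ 0} => Projectivization.mk 𝕜 v.1 v.2)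
    inferInstance

variable (𝕜 d) in
/-- The Grassmannian of hyperplanes of `𝕜^d`, i.e. of linear subspaces of codimension one. -/
def Hyperplane : Type _ :=
  {W : Submodule 𝕜 (EuclideanSpace 𝕜 (Fin d)) // Module.finrank 𝕜 W + 1 = d}

/-- The hyperplane orthogonal to a nonzero vector. Every hyperplane is of this form. -/
def Hyperplane.ofNormal (v : {v : EuclideanSpace 𝕜 (Fin d) // v ≠ 0}) : Hyperplane 𝕜 d :=
  ⟨(𝕜 ∙ v.1)ᗮ, by
    have h := Submodule.finrank_add_finrank_orthogonal (𝕜 ∙ v.1)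
    rw [finrank_span_singleton v.2, finrank_euclideanSpace_fin] at h
    omega⟩

/-- Two hyperplanes are close when their normal lines are: the quotient topology
under `v ↦ v^⊥`, which is the usual topology of the Grassmannian. -/
instance instTopologicalSpaceHyperplane : TopologicalSpace (Hyperplane 𝕜 d) :=
  TopologicalSpace.coinduced Hyperplane.ofNormal inferInstance

/-- The linear endomorphism of `𝕜^d` given by an invertible matrix. -/
def lin (g : GL (Fin d) 𝕜) : EuclideanSpace 𝕜 (Fin d) →ₗ[𝕜] EuclideanSpace 𝕜 (Fin d) :=
  Matrix.toEuclideanLin (g : Matrix (Fin d) (Fin d) 𝕜)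

theorem lin_injective (g : GL (Fin d) 𝕜) : Function.Injective (lin g) := by
  have h : Function.LeftInverse (lin g⁻¹) (lin g) := fun x => by
    apply WithLp.ofLp_injective
    simp only [lin, Matrix.ofLp_toLpLin, Matrix.toLin'_apply, Matrix.mulVec_mulVec,
      ← Units.val_mul, inv_mul_cancel, Units.val_one, Matrix.one_mulVec]
  exact h.injective

/-- The action of `g` on points of projective space, `[v] ↦ [g v]`. -/
def projAct (g : GL (Fin d) 𝕜) :
    ℙ 𝕜 (EuclideanSpace 𝕜 (Fin d)) → ℙ 𝕜 (EuclideanSpace 𝕜 (Fin d)) :=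
  Projectivization.map (lin g) (lin_injective g)

/-- The action of `g` on hyperplanes, `W ↦ g W`. -/
def hypAct (g : GL (Fin d) 𝕜) (W : Hyperplane 𝕜 d) : Hyperplane 𝕜 d :=
  ⟨W.1.map (lin g), by
    rw [← (Submodule.equivMapOfInjective (lin g) (lin_injective g) W.1).finrank_eq]
    exact W.2⟩

/-- A point `[v]` and a hyperplane `W` are transverse when `v ∉ W`. -/
def Transverse (x : ℙ 𝕜 (EuclideanSpace 𝕜 (Fin d))) (W : Hyperplane 𝕜 d) : Prop :=
  ¬ x.submodule ≤ W.1

/-! ### Singular values and moduli of eigenvalues -/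

/-- `sigma i g` is the `i`-th largest singular value of `g`, for `1 ≤ i ≤ d`. -/
def sigma (i : ℕ) (g : GL (Fin d) 𝕜) : ℝ :=
  (lin g).singularValues (i - 1)

/-- The inclusion of the real or complex field `𝕜` into `ℂ`. -/
def toComplex : 𝕜 →+* ℂ where
  toFun x := ⟨RCLike.re x, RCLike.im x⟩
  map_one' := by apply Complex.ext <;> simp
  map_mul' x y := by apply Complex.ext <;> simp
  map_zero' := by apply Complex.ext <;> simp
  map_add' x y := by apply Complex.ext <;> simp

/-- `ell i g` is the `i`-th largest modulus of a complex eigenvalue of `g`, for `1 ≤ i ≤ d`,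
eigenvalues being counted with algebraic multiplicity. -/
def ell (i : ℕ) (g : GL (Fin d) 𝕜) : ℝ :=
  ((((g : Matrix (Fin d) (Fin d) 𝕜).charpoly.map toComplex).roots.map (fun z => ‖z‖)).sort
    (· ≥ ·)).getD (i - 1) 0

/-! ### Divergent semigroups, ping-pong position, reduced words -/

/-- A semigroup `Γ` is `k`-divergent if `σ_k / σ_{k+1}` tends to infinity along every sequence of
pairwise distinct elements of `Γ`. -/
def IsDivergent (k : ℕ) (Γ : Subsemigroup (GL (Fin d) 𝕜)) : Prop :=
  ∀ γ : ℕ → GL (Fin d) 𝕜, Function.Injective γ → (∀ n, γ n ∈ Γ) →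
    Tendsto (fun n => sigma k (γ n) / sigma (k + 1) (γ n)) atTop atTop

/-- The semigroups `Γ 0`, `Γ 1` are in ping-pong position relative to the open sets `U 0`, `U 1` of
points and `V 0`, `V 1` of hyperplanes. -/
structure InPingPongPosition (Γ : Fin 2 → Subsemigroup (GL (Fin d) 𝕜))
    (U : Fin 2 → Set (ℙ 𝕜 (EuclideanSpace 𝕜 (Fin d))))
    (V : Fin 2 → Set (Hyperplane 𝕜 d)) : Prop where
  isOpen_points : ∀ i, IsOpen (U i)
  isOpen_hyperplanes : ∀ i, IsOpen (V i)
  transverse : ∀ i j, i ≠ j → ∀ x ∈ closure (U i), ∀ W ∈ closure (V j), Transverse x W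
  map_points : ∀ i j, i ≠ j → ∀ γ ∈ Γ i, γ ≠ 1 → projAct γ '' closure (U j) ⊆ U i
  map_hyperplanes : ∀ i j, i ≠ j → ∀ γ ∈ Γ i, γ ≠ 1 → hypAct γ⁻¹ '' closure (V j) ⊆ V i

/-- The list `w = [γ₁, …, γ_n]` is a reduced word in `Γ 0` and `Γ 1`: `n ≥ 2`, all `γ_k` are
nontrivial, and they are taken from the two semigroups in alternation (`γ_k` from `Γ (s k)`).
If `Γ 0` and `Γ 1` share a nontrivial element, it may be used as a letter of either one. -/
def IsReducedWord (Γ : Fin 2 → Subsemigroup (GL (Fin d) 𝕜)) (w : List (GL (Fin d) 𝕜)) : Prop :=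
  2 ≤ w.length ∧ (∀ γ ∈ w, γ ≠ 1) ∧
    ∃ s : Fin w.length → Fin 2, (∀ k, w.get k ∈ Γ (s k)) ∧
      ∀ k l : Fin w.length, (k : ℕ) + 1 = l → s k ≠ s l

end PingPong

end

/-!
Lift everything to vectors. Let `A i` be the cone of vectors over `U i` and `B i` the cone of normal
vectors of the hyperplanes in `V i`. Ping-pong position says that a letter `γ` of `Γ i` maps `A j`
into `A i` and that its adjoint maps `B j` into `B i`, for `j ≠ i`, and compactness makes the
transversality uniform: `|⟪w, x⟫| ≥ ε ‖w‖ ‖x‖` for `x ∈ A j` and `w ∈ B i`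
(`InPingPongPosition.exists_isConeSystem`).

*Expansion.* For `x ∈ A j` and `w ∈ B j`, the vector `γ† w` lies in `B i`, so that
`‖w‖ ‖γ x‖ ≥ |⟪γ† w, x⟫| ≥ ε ‖γ† w‖ ‖x‖`. As `B j` is open, some such `w` has `‖γ† w‖` comparable to
`σ₁(γ) ‖w‖`; hence `‖γ x‖ ≥ c σ₁(γ) ‖x‖` on `A j` (`IsConeSystem.le_norm_lin`). Iterating along a
word gives the lower bound for `σ₁` of the product. Since `σ₁ σ₂` is the operator norm on bivectors,
it is submultiplicative (`norm_wedge_lin_le`), and the lower bound for `σ₁ / σ₂ = σ₁² / (σ₁ σ₂)`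
follows.

*Exponential growth.* On the tangent vectors `y` at `x ∈ A j` consider the diameter of the set of
quotients `⟪q, y⟫ / ⟪q, x⟫`, `q ∈ B i`, an infinitesimal Hilbert metric (`CrossBound`). It is
equivalent to the angular metric `‖x ∧ y‖ / ‖x‖²`. A letter does not increase it, since
`γ† (B j) ⊆ B i`. It even contracts it by a uniform factor `κ < 1`
(`IsConeSystem.exists_contraction`): each of the finitely many letters with a small gap leaves room
around `γ† (B j)` inside `B i`, which shrinks the diameter; each of the others contracts the angular
metric by `σ₂ / σ₁` up to a constant. Thus the product of a word of length `n` contracts the angular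
metric on a cone by `κ ^ n`, and because the cone is open, `σ₂ / σ₁` of the product is at most a
constant times `κ ^ n`.

*Eigenvalues.* A word of even length maps some `A i` into itself, so the expansion estimate holds for
its powers, and Gelfand's formula bounds `ℓ₁` from below (`le_ell_one`). The product `ℓ₁ ℓ₂` is the
modulus of the determinant on an invariant complex plane, so it is at most the growth rate of the
powers on bivectors (`ell_mul_ell_le`). Then `ℓ₁ / ℓ₂ = ℓ₁² / (ℓ₁ ℓ₂)`.
-/

noncomputable section

namespace PingPong

/-! ### Bivectors and the first two singular values -/

/-- The bivector `x ∧ y` through its Plücker coordinates `x_a y_b - x_b y_a`. Every coordinate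
occurs twice up to sign, so that `‖x ∧ y‖` is `√2` times the area spanned by `x` and `y`. -/
def wedge {𝕜 : Type*} [RCLike 𝕜] {d : ℕ} (x y : EuclideanSpace 𝕜 (Fin d)) :
    EuclideanSpace 𝕜 (Fin d × Fin d) :=
  WithLp.toLp 2 fun p => x p.1 * y p.2 - x p.2 * y p.1

section Wedge

variable {𝕜 : Type*} [RCLike 𝕜] {d : ℕ}

@[simp]
theorem wedge_apply (x y : EuclideanSpace 𝕜 (Fin d)) (p : Fin d × Fin d) :
    wedge x y p = x p.1 * y p.2 - x p.2 * y p.1 := rfl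

theorem wedge_sub_left (x x' y : EuclideanSpace 𝕜 (Fin d)) :
    wedge (x - x') y = wedge x y - wedge x' y := by
  ext p; simp; ring

theorem wedge_smul_left (c : 𝕜) (x y : EuclideanSpace 𝕜 (Fin d)) :
    wedge (c • x) y = c • wedge x y := by
  ext p; simp; ring

theorem wedge_add_smul_right (c : 𝕜) (x y : EuclideanSpace 𝕜 (Fin d)) :
    wedge x (y + c • x) = wedge x y := by
  ext p; simp; ring

/-- Lagrange's identity with weights. -/
theorem weighted_lagrange {ι : Type*} [Fintype ι] (w : ι → ℝ) (a b : ι → 𝕜) :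
    ∑ i, ∑ j, w i * w j * ‖a i * b j - a j * b i‖ ^ 2 =
      2 * ((∑ i, w i * ‖a i‖ ^ 2) * (∑ i, w i * ‖b i‖ ^ 2) -
        ‖∑ i, (w i : 𝕜) * (starRingEnd 𝕜 (a i) * b i)‖ ^ 2) := by
  have key : ∀ i j, ((w i * w j * ‖a i * b j - a j * b i‖ ^ 2 : ℝ) : 𝕜) =
      (w i * (starRingEnd 𝕜 (a i) * a i)) * (w j * (starRingEnd 𝕜 (b j) * b j)) +
      (w i * (starRingEnd 𝕜 (b i) * b i)) * (w j * (starRingEnd 𝕜 (a j) * a j)) -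
      ((w i * (starRingEnd 𝕜 (a i) * b i)) * (w j * (a j * starRingEnd 𝕜 (b j))) +
      (w i * (a i * starRingEnd 𝕜 (b i))) * (w j * (starRingEnd 𝕜 (a j) * b j))) := by
    intro i j
    push_cast
    rw [← RCLike.conj_mul, map_sub, map_mul, map_mul]
    ring
  have hconj : starRingEnd 𝕜 (∑ i, (w i : 𝕜) * (starRingEnd 𝕜 (a i) * b i)) =
      ∑ i, (w i : 𝕜) * (a i * starRingEnd 𝕜 (b i)) := by
    simp [map_sum]
  have hcast : ∀ c : ι → 𝕜, ((∑ i, w i * ‖c i‖ ^ 2 : ℝ) : 𝕜) =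
      ∑ i, (w i : 𝕜) * (starRingEnd 𝕜 (c i) * c i) := by
    intro c; push_cast; simp only [RCLike.conj_mul]
  have := RCLike.ofReal_injective (K := 𝕜)
  apply this
  rw [RCLike.ofReal_sum]
  simp only [RCLike.ofReal_sum, key, Finset.sum_sub_distrib, Finset.sum_add_distrib,
    ← Finset.mul_sum, ← Finset.sum_mul]
  rw [RCLike.ofReal_mul, RCLike.ofReal_sub, RCLike.ofReal_mul, hcast, hcast, RCLike.ofReal_pow,
    ← RCLike.conj_mul, hconj]
  push_cast
  ring

theorem norm_wedge_sq (x y : EuclideanSpace 𝕜 (Fin d)) :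
    ‖wedge x y‖ ^ 2 = 2 * (‖x‖ ^ 2 * ‖y‖ ^ 2 - ‖inner 𝕜 x y‖ ^ 2) := by
  have h := weighted_lagrange (𝕜 := 𝕜) (fun _ => 1) x.ofLp y.ofLp
  simp only [RCLike.ofReal_one, one_mul] at h
  rw [EuclideanSpace.norm_sq_eq, EuclideanSpace.norm_sq_eq, EuclideanSpace.norm_sq_eq,
    Fintype.sum_prod_type, PiLp.inner_apply]
  simp only [RCLike.inner_apply, wedge_apply]
  rw [h]
  simp only [mul_comm]

theorem norm_wedge_le (x y : EuclideanSpace 𝕜 (Fin d)) : ‖wedge x y‖ ≤ 2 * ‖x‖ * ‖y‖ := by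
  apply le_of_sq_le_sq _ (by positivity)
  rw [norm_wedge_sq]
  nlinarith [sq_nonneg ‖inner 𝕜 x y‖, mul_nonneg (sq_nonneg ‖x‖) (sq_nonneg ‖y‖)]

/-- For orthogonal vectors the area is at least the product of the lengths. -/
theorem mul_norm_le_norm_wedge {x y : EuclideanSpace 𝕜 (Fin d)} (h : inner 𝕜 x y = 0) :
    ‖x‖ * ‖y‖ ≤ ‖wedge x y‖ := by
  apply le_of_sq_le_sq _ (by positivity)
  rw [norm_wedge_sq, h]
  nlinarith [mul_nonneg (sq_nonneg ‖x‖) (sq_nonneg ‖y‖), norm_zero (E := 𝕜)]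

end Wedge

section SingularValues

variable {𝕜 : Type*} [RCLike 𝕜] {d : ℕ}

/-- The eigenvectors of `T† T` form an orthonormal basis in which the form `⟪T x, T y⟫` is diagonal,
with the squared singular values as entries. -/
theorem exists_orthonormalBasis_inner_map
    (T : EuclideanSpace 𝕜 (Fin d) →ₗ[𝕜] EuclideanSpace 𝕜 (Fin d)) :
    ∃ b : OrthonormalBasis (Fin d) 𝕜 (EuclideanSpace 𝕜 (Fin d)), ∀ x y,
      inner 𝕜 (T x) (T y) = ∑ i : Fin d, ((T.singularValues i ^ 2 : ℝ) : 𝕜) *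
        (starRingEnd 𝕜 (b.repr x i) * b.repr y i) := by
  have hn : Module.finrank 𝕜 (EuclideanSpace 𝕜 (Fin d)) = d := finrank_euclideanSpace_fin
  have hS := T.isSymmetric_adjoint_comp_self
  refine ⟨hS.eigenvectorBasis hn, fun x y => ?_⟩
  set b := hS.eigenvectorBasis hn
  rw [← LinearMap.adjoint_inner_left, ← LinearMap.comp_apply, ← b.sum_inner_mul_inner]
  refine Finset.sum_congr rfl fun i _ => ?_
  rw [hS x (b i), hS.apply_eigenvectorBasis hn i, inner_smul_right, T.sq_singularValues_fin hn i,
    b.repr_apply_apply, b.repr_apply_apply, inner_conj_symm, mul_assoc]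

theorem norm_map_sq_eq_of_diagonal
    {T : EuclideanSpace 𝕜 (Fin d) →ₗ[𝕜] EuclideanSpace 𝕜 (Fin d)}
    {b : OrthonormalBasis (Fin d) 𝕜 (EuclideanSpace 𝕜 (Fin d))}
    (hb : ∀ x y, inner 𝕜 (T x) (T y) = ∑ i : Fin d, ((T.singularValues i ^ 2 : ℝ) : 𝕜) *
        (starRingEnd 𝕜 (b.repr x i) * b.repr y i)) (x : EuclideanSpace 𝕜 (Fin d)) :
    ‖T x‖ ^ 2 = ∑ i : Fin d, T.singularValues i ^ 2 * ‖b.repr x i‖ ^ 2 := by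
  apply RCLike.ofReal_injective (K := 𝕜)
  rw [RCLike.ofReal_pow, ← inner_self_eq_norm_sq_to_K, hb]
  push_cast
  simp only [RCLike.conj_mul]

theorem norm_lin_le (g : GL (Fin d) 𝕜) (x : EuclideanSpace 𝕜 (Fin d)) :
    ‖lin g x‖ ≤ sigma 1 g * ‖x‖ := by
  obtain ⟨b, hb⟩ := exists_orthonormalBasis_inner_map (lin g)
  have h0 := (lin g).singularValues_nonneg
  apply le_of_sq_le_sq _ (mul_nonneg (h0 0) (norm_nonneg x))
  rw [norm_map_sq_eq_of_diagonal hb, mul_pow, ← b.repr.norm_map x, EuclideanSpace.norm_sq_eq,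
    Finset.mul_sum]
  refine Finset.sum_le_sum fun i _ => mul_le_mul_of_nonneg_right ?_ (sq_nonneg _)
  exact pow_le_pow_left₀ (h0 _) ((lin g).singularValues_antitone (Nat.zero_le _)) 2

theorem norm_wedge_lin_sq_eq_of_diagonal
    {T : EuclideanSpace 𝕜 (Fin d) →ₗ[𝕜] EuclideanSpace 𝕜 (Fin d)}
    {b : OrthonormalBasis (Fin d) 𝕜 (EuclideanSpace 𝕜 (Fin d))}
    (hb : ∀ x y, inner 𝕜 (T x) (T y) = ∑ i : Fin d, ((T.singularValues i ^ 2 : ℝ) : 𝕜) *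
        (starRingEnd 𝕜 (b.repr x i) * b.repr y i)) (x y : EuclideanSpace 𝕜 (Fin d)) :
    ‖wedge (T x) (T y)‖ ^ 2 = ∑ i : Fin d, ∑ j : Fin d,
      T.singularValues i ^ 2 * T.singularValues j ^ 2 *
        ‖b.repr x i * b.repr y j - b.repr x j * b.repr y i‖ ^ 2 := by
  rw [weighted_lagrange (fun i : Fin d => T.singularValues i ^ 2), norm_wedge_sq,
    norm_map_sq_eq_of_diagonal hb, norm_map_sq_eq_of_diagonal hb, hb]

theorem norm_wedge_repr (b : OrthonormalBasis (Fin d) 𝕜 (EuclideanSpace 𝕜 (Fin d)))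
    (x y : EuclideanSpace 𝕜 (Fin d)) : ‖wedge (b.repr x) (b.repr y)‖ = ‖wedge x y‖ := by
  rw [← sq_eq_sq₀ (norm_nonneg _) (norm_nonneg _), norm_wedge_sq, norm_wedge_sq,
    b.repr.norm_map, b.repr.norm_map, b.repr.inner_map_map]

theorem sigma_nonneg (i : ℕ) (g : GL (Fin d) 𝕜) : 0 ≤ sigma i g :=
  (lin g).singularValues_nonneg _

/-- The operator norm of `g` on bivectors is at most `σ₁ σ₂`. -/
theorem norm_wedge_lin_le (g : GL (Fin d) 𝕜) (x y : EuclideanSpace 𝕜 (Fin d)) :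
    ‖wedge (lin g x) (lin g y)‖ ≤ sigma 1 g * sigma 2 g * ‖wedge x y‖ := by
  obtain ⟨b, hb⟩ := exists_orthonormalBasis_inner_map (lin g)
  have h0 := (lin g).singularValues_nonneg
  have hanti := (lin g).singularValues_antitone
  apply le_of_sq_le_sq _
    (mul_nonneg (mul_nonneg (sigma_nonneg 1 g) (sigma_nonneg 2 g)) (norm_nonneg _))
  rw [norm_wedge_lin_sq_eq_of_diagonal hb, mul_pow, ← norm_wedge_repr b x y,
    EuclideanSpace.norm_sq_eq, Fintype.sum_prod_type, Finset.mul_sum]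
  refine Finset.sum_le_sum fun i _ => ?_
  rw [Finset.mul_sum]
  refine Finset.sum_le_sum fun j _ => ?_
  rcases eq_or_ne i j with rfl | hij
  · simp
  refine mul_le_mul_of_nonneg_right ?_ (sq_nonneg _)
  rw [← mul_pow]
  refine pow_le_pow_left₀ (mul_nonneg (h0 _) (h0 _)) ?_ 2
  have hij' : (i : ℕ) ≠ j := fun h => hij (Fin.ext h)
  rcases lt_or_gt_of_ne hij' with h | h
  · exact mul_le_mul (hanti (Nat.zero_le _)) (hanti (show 1 ≤ (j : ℕ) by omega)) (h0 _) (h0 _)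
  · rw [mul_comm]
    exact mul_le_mul (hanti (Nat.zero_le _)) (hanti (show 1 ≤ (i : ℕ) by omega)) (h0 _) (h0 _)

theorem sigma_pos (hd : 2 ≤ d) {i : ℕ} (hi : i ≤ 2) (g : GL (Fin d) 𝕜) : 0 < sigma i g := by
  refine (lin g).injective_iff_forall_lt_finrank_singularValues_pos.1 (lin_injective g) _ ?_
  rw [finrank_euclideanSpace_fin]
  omega

/-- The bound `norm_wedge_lin_le` is attained, up to normalization, on two right singular vectors;
the first of them realizes the operator norm `σ₁`. -/
theorem exists_singular_pair (hd : 2 ≤ d) (g : GL (Fin d) 𝕜) :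
    ∃ u v : EuclideanSpace 𝕜 (Fin d), ‖u‖ = 1 ∧ ‖v‖ = 1 ∧ ‖lin g u‖ = sigma 1 g ∧
      sigma 1 g * sigma 2 g ≤ ‖wedge (lin g u) (lin g v)‖ := by
  obtain ⟨b, hb⟩ := exists_orthonormalBasis_inner_map (lin g)
  set i0 : Fin d := ⟨0, by omega⟩
  set i1 : Fin d := ⟨1, by omega⟩
  have hne : i0 ≠ i1 := by simp [i0, i1]
  have hnorm : ∀ i : Fin d, ‖lin g (b i)‖ = (lin g).singularValues i := by
    intro i
    rw [← sq_eq_sq₀ (norm_nonneg _) ((lin g).singularValues_nonneg _),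
      norm_map_sq_eq_of_diagonal hb]
    simp [b.repr_self, apply_ite, ite_pow]
  have hinner : inner 𝕜 (lin g (b i0)) (lin g (b i1)) = 0 := by
    rw [hb]
    refine Finset.sum_eq_zero fun i _ => ?_
    rcases eq_or_ne i i0 with rfl | h
    · simp [b.repr_self, hne]
    · simp [b.repr_self, h]
  refine ⟨b i0, b i1, b.orthonormal.1 _, b.orthonormal.1 _, hnorm i0, ?_⟩
  have := mul_norm_le_norm_wedge hinner
  rwa [hnorm, hnorm] at this

theorem lin_mul_apply (g h : GL (Fin d) 𝕜) (x : EuclideanSpace 𝕜 (Fin d)) :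
    lin (g * h) x = lin g (lin h x) := by
  apply WithLp.ofLp_injective
  simp only [lin, Matrix.ofLp_toLpLin, Matrix.toLin'_apply, Matrix.mulVec_mulVec, Units.val_mul]

theorem lin_one_apply (x : EuclideanSpace 𝕜 (Fin d)) : lin (1 : GL (Fin d) 𝕜) x = x := by
  apply WithLp.ofLp_injective
  simp only [lin, Matrix.ofLp_toLpLin, Matrix.toLin'_apply, Units.val_one, Matrix.one_mulVec]

theorem norm_wedge_lin_prod_le (w : List (GL (Fin d) 𝕜)) (x y : EuclideanSpace 𝕜 (Fin d)) :
    ‖wedge (lin w.prod x) (lin w.prod y)‖ ≤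
      (w.map fun γ => sigma 1 γ * sigma 2 γ).prod * ‖wedge x y‖ := by
  induction w with
  | nil => simp [lin_one_apply]
  | cons γ w ih =>
    rw [List.prod_cons, lin_mul_apply, lin_mul_apply, List.map_cons, List.prod_cons, mul_assoc]
    exact (norm_wedge_lin_le γ _ _).trans
      (mul_le_mul_of_nonneg_left ih (mul_nonneg (sigma_nonneg _ _) (sigma_nonneg _ _)))

/-- Submultiplicativity of `σ₁ σ₂` along a product; the factor `2` comes from `norm_wedge_le`. -/
theorem sigma_mul_sigma_prod_le (hd : 2 ≤ d) (w : List (GL (Fin d) 𝕜)) :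
    sigma 1 w.prod * sigma 2 w.prod ≤ 2 * (w.map fun γ => sigma 1 γ * sigma 2 γ).prod := by
  obtain ⟨u, v, hu, hv, -, h⟩ := exists_singular_pair hd w.prod
  have hP : 0 ≤ (w.map fun γ => sigma 1 γ * sigma 2 γ).prod :=
    List.prod_nonneg fun a ha => by
      obtain ⟨γ, -, rfl⟩ := List.mem_map.1 ha
      exact mul_nonneg (sigma_nonneg _ _) (sigma_nonneg _ _)
  have h1 := norm_wedge_lin_prod_le w u v
  have h2 := norm_wedge_le u v
  rw [hu, hv] at h2
  nlinarith

end SingularValues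

/-! ### Cones over open sets of points and of hyperplanes -/

section Cones

variable {𝕜 : Type*} [RCLike 𝕜] {d : ℕ}

/-- The nonzero vectors whose line belongs to `S`. -/
def pointCone (S : Set (ℙ 𝕜 (EuclideanSpace 𝕜 (Fin d)))) : Set (EuclideanSpace 𝕜 (Fin d)) :=
  {x | ∃ h : x ≠ 0, Projectivization.mk 𝕜 x h ∈ S}

/-- The nonzero vectors whose orthogonal hyperplane belongs to `S`. -/
def normalCone (S : Set (Hyperplane 𝕜 d)) : Set (EuclideanSpace 𝕜 (Fin d)) :=
  {w | ∃ h : w ≠ 0, Hyperplane.ofNormal ⟨w, h⟩ ∈ S}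

theorem isOpen_pointCone {S : Set (ℙ 𝕜 (EuclideanSpace 𝕜 (Fin d)))} (hS : IsOpen S) :
    IsOpen (pointCone S) := by
  have h := isOpen_compl_singleton.isOpenMap_subtype_val _ (isOpen_coinduced.1 hS)
  convert h using 1
  ext x
  exact ⟨fun ⟨h0, hx⟩ => ⟨⟨x, h0⟩, hx, rfl⟩, fun ⟨y, hy, e⟩ => e ▸ ⟨y.2, hy⟩⟩

theorem isOpen_normalCone {S : Set (Hyperplane 𝕜 d)} (hS : IsOpen S) :
    IsOpen (normalCone S) := by
  have h := isOpen_compl_singleton.isOpenMap_subtype_val _ (isOpen_coinduced.1 hS)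
  convert h using 1
  ext x
  exact ⟨fun ⟨h0, hx⟩ => ⟨⟨x, h0⟩, hx, rfl⟩, fun ⟨y, hy, e⟩ => e ▸ ⟨y.2, hy⟩⟩

theorem isCompact_pointCone_inter_sphere {S : Set (ℙ 𝕜 (EuclideanSpace 𝕜 (Fin d)))}
    (hS : IsClosed S) : IsCompact (pointCone S ∩ Metric.sphere 0 1) := by
  obtain ⟨T, hT, hTS⟩ := isClosed_induced_iff.1 (isClosed_coinduced.1 hS)
  have h : pointCone S ∩ Metric.sphere 0 1 = T ∩ Metric.sphere 0 1 := by
    ext x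
    refine and_congr_left fun hx => ?_
    have hx0 : x ≠ 0 := by rintro rfl; simp at hx
    have := Set.ext_iff.1 hTS ⟨x, hx0⟩
    simpa [pointCone, hx0, Set.mem_preimage] using this.symm
  rw [h]
  exact (isCompact_sphere (0 : EuclideanSpace 𝕜 (Fin d)) 1).inter_left hT

theorem isCompact_normalCone_inter_sphere {S : Set (Hyperplane 𝕜 d)}
    (hS : IsClosed S) : IsCompact (normalCone S ∩ Metric.sphere 0 1) := by
  obtain ⟨T, hT, hTS⟩ := isClosed_induced_iff.1 (isClosed_coinduced.1 hS)
  have h : normalCone S ∩ Metric.sphere 0 1 = T ∩ Metric.sphere 0 1 := by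
    ext x
    refine and_congr_left fun hx => ?_
    have hx0 : x ≠ 0 := by rintro rfl; simp at hx
    have := Set.ext_iff.1 hTS ⟨x, hx0⟩
    simpa [normalCone, hx0, Set.mem_preimage] using this.symm
  rw [h]
  exact (isCompact_sphere (0 : EuclideanSpace 𝕜 (Fin d)) 1).inter_left hT

theorem smul_mem_pointCone {S : Set (ℙ 𝕜 (EuclideanSpace 𝕜 (Fin d)))}
    {c : 𝕜} (hc : c ≠ 0) {x : EuclideanSpace 𝕜 (Fin d)} (hx : x ∈ pointCone S) :
    c • x ∈ pointCone S := by
  obtain ⟨h0, h⟩ := hx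
  refine ⟨smul_ne_zero hc h0, ?_⟩
  rwa [(Projectivization.mk_eq_mk_iff' 𝕜 (c • x) x (smul_ne_zero hc h0) h0).2 ⟨c, rfl⟩]

theorem smul_mem_normalCone {S : Set (Hyperplane 𝕜 d)}
    {c : 𝕜} (hc : c ≠ 0) {x : EuclideanSpace 𝕜 (Fin d)} (hx : x ∈ normalCone S) :
    c • x ∈ normalCone S := by
  obtain ⟨h0, h⟩ := hx
  refine ⟨smul_ne_zero hc h0, ?_⟩
  convert h using 1
  apply Subtype.ext
  change (𝕜 ∙ (c • x))ᗮ = (𝕜 ∙ x)ᗮ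
  rw [Submodule.span_singleton_smul_eq (IsUnit.mk0 c hc)]

theorem pointCone_mono {S T : Set (ℙ 𝕜 (EuclideanSpace 𝕜 (Fin d)))} (h : S ⊆ T) :
    pointCone S ⊆ pointCone T := fun _ hx => ⟨hx.1, h hx.2⟩

theorem normalCone_mono {S T : Set (Hyperplane 𝕜 d)} (h : S ⊆ T) :
    normalCone S ⊆ normalCone T := fun _ hx => ⟨hx.1, h hx.2⟩

theorem pointCone_nonempty {S : Set (ℙ 𝕜 (EuclideanSpace 𝕜 (Fin d)))} (h : S.Nonempty) :
    (pointCone S).Nonempty := by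
  obtain ⟨x, hx⟩ := h
  exact ⟨x.rep, x.rep_nonzero, by rwa [x.mk_rep]⟩

theorem normalCone_nonempty {S : Set (Hyperplane 𝕜 d)} (h : S.Nonempty) :
    (normalCone S).Nonempty := by
  obtain ⟨W, hW⟩ := h
  have hrank : Module.finrank 𝕜 W.1ᗮ = 1 := by
    have h := Submodule.finrank_add_finrank_orthogonal W.1
    rw [finrank_euclideanSpace_fin] at h
    have := W.2
    omega
  obtain ⟨w, hw0, hw⟩ := finrank_eq_one_iff'.1 hrank
  have hw0' : (w : EuclideanSpace 𝕜 (Fin d)) ≠ 0 := by simpa using hw0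
  refine ⟨w, hw0', ?_⟩
  convert hW using 1
  apply Subtype.ext
  change (𝕜 ∙ (w : EuclideanSpace 𝕜 (Fin d)))ᗮ = W.1
  refine Eq.trans (congrArg _ ?_) (Submodule.orthogonal_orthogonal W.1)
  refine le_antisymm ((Submodule.span_singleton_le_iff_mem _ _).2 w.2) fun v hv => ?_
  obtain ⟨c, hc⟩ := hw ⟨v, hv⟩
  exact Submodule.mem_span_singleton.2 ⟨c, by simpa using congrArg Subtype.val hc⟩

theorem lin_mem_pointCone {S T : Set (ℙ 𝕜 (EuclideanSpace 𝕜 (Fin d)))} {g : GL (Fin d) 𝕜}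
    (h : projAct g '' S ⊆ T) {x : EuclideanSpace 𝕜 (Fin d)} (hx : x ∈ pointCone S) :
    lin g x ∈ pointCone T := by
  obtain ⟨h0, hx⟩ := hx
  exact ⟨(map_ne_zero_iff _ (lin_injective g)).2 h0, h ⟨_, hx, rfl⟩⟩

theorem adjoint_lin_injective (g : GL (Fin d) 𝕜) :
    Function.Injective (LinearMap.adjoint (lin g)) := by
  refine (injective_iff_map_eq_zero _).2 fun w hw => ?_
  have : lin g (lin g⁻¹ w) = w := by rw [← lin_mul_apply, mul_inv_cancel, lin_one_apply]
  rw [← inner_self_eq_zero (𝕜 := 𝕜)]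
  nth_rewrite 2 [← this]
  rw [← LinearMap.adjoint_inner_left, hw, inner_zero_left]

theorem adjoint_mem_normalCone {S T : Set (Hyperplane 𝕜 d)} {g : GL (Fin d) 𝕜}
    (h : hypAct g⁻¹ '' S ⊆ T) {w : EuclideanSpace 𝕜 (Fin d)} (hw : w ∈ normalCone S) :
    LinearMap.adjoint (lin g) w ∈ normalCone T := by
  obtain ⟨h0, hw⟩ := hw
  have h1 : LinearMap.adjoint (lin g) w ≠ 0 :=
    (map_ne_zero_iff _ (adjoint_lin_injective g)).2 h0
  refine ⟨h1, ?_⟩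
  convert h ⟨_, hw, rfl⟩ using 1
  apply Subtype.ext
  change (𝕜 ∙ LinearMap.adjoint (lin g) w)ᗮ = ((𝕜 ∙ w)ᗮ).map (lin g⁻¹)
  ext z
  rw [Submodule.mem_orthogonal_singleton_iff_inner_right, LinearMap.adjoint_inner_left,
    Submodule.mem_map]
  constructor
  · intro hz
    refine ⟨lin g z, Submodule.mem_orthogonal_singleton_iff_inner_right.2 hz, ?_⟩
    rw [← lin_mul_apply, inv_mul_cancel, lin_one_apply]
  · rintro ⟨y, hy, rfl⟩
    rw [← lin_mul_apply, mul_inv_cancel, lin_one_apply]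
    exact Submodule.mem_orthogonal_singleton_iff_inner_right.1 hy

theorem inner_ne_zero_of_transverse {x w : EuclideanSpace 𝕜 (Fin d)} (hx : x ≠ 0) (hw : w ≠ 0)
    (h : Transverse (Projectivization.mk 𝕜 x hx) (Hyperplane.ofNormal ⟨w, hw⟩)) :
    inner 𝕜 w x ≠ 0 := by
  intro h0
  apply h
  rw [Projectivization.submodule_mk, Submodule.span_singleton_le_iff_mem]
  exact Submodule.mem_orthogonal_singleton_iff_inner_right.2 h0

end Cones

/-! ### Uniform constants by compactness -/

theorem exists_pos_le_of_finite {ι : Type*} [Finite ι] (f : ι → ℝ) (hf : ∀ i, 0 < f i) :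
    ∃ c, 0 < c ∧ ∀ i, c ≤ f i := by
  cases isEmpty_or_nonempty ι
  · exact ⟨1, one_pos, fun i => isEmptyElim i⟩
  · obtain ⟨i, hi⟩ := Finite.exists_min f
    exact ⟨f i, hf i, hi⟩

section Compactness

variable {𝕜 : Type*} [RCLike 𝕜] {E : Type*} [NormedAddCommGroup E] [InnerProductSpace 𝕜 E]

/-- Rescaling a nonzero element of a cone to the unit sphere. -/
theorem exists_smul_mem_sphere {C : Set E} (hC : ∀ c : 𝕜, c ≠ 0 → ∀ x ∈ C, c • x ∈ C) {x : E}
    (hx : x ∈ C) (h0 : x ≠ 0) : ∃ u ∈ C ∩ Metric.sphere 0 1, x = (‖x‖ : 𝕜) • u := by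
  have hn : (‖x‖ : 𝕜) ≠ 0 := by simpa using h0
  refine ⟨(‖x‖ : 𝕜)⁻¹ • x, ⟨hC _ (inv_ne_zero hn) x hx, ?_⟩, (smul_inv_smul₀ hn x).symm⟩
  simp [norm_smul, h0]

/-- Two transverse cones with compact bases are uniformly transverse. -/
theorem exists_uniform_transversality {C D : Set E}
    (hC : ∀ c : 𝕜, c ≠ 0 → ∀ x ∈ C, c • x ∈ C) (hD : ∀ c : 𝕜, c ≠ 0 → ∀ x ∈ D, c • x ∈ D)
    (hCc : IsCompact (C ∩ Metric.sphere 0 1)) (hDc : IsCompact (D ∩ Metric.sphere 0 1))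
    (h : ∀ x ∈ C, ∀ w ∈ D, inner 𝕜 w x ≠ 0) :
    ∃ ε, 0 < ε ∧ ∀ x ∈ C, ∀ w ∈ D, ε * ‖w‖ * ‖x‖ ≤ ‖inner 𝕜 w x‖ := by
  have h0 : ∀ x ∈ C, ∀ w ∈ D, x ≠ 0 ∧ w ≠ 0 := fun x hx w hw =>
    ⟨fun e => h x hx w hw (by simp [e]), fun e => h x hx w hw (by simp [e])⟩
  rcases (((C ∩ Metric.sphere 0 1) ×ˢ (D ∩ Metric.sphere 0 1) : Set (E × E))).eq_empty_or_nonempty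
    with he | hne
  · refine ⟨1, one_pos, fun x hx w hw => ?_⟩
    obtain ⟨u, hu, -⟩ := exists_smul_mem_sphere hC hx (h0 x hx w hw).1
    obtain ⟨v, hv, -⟩ := exists_smul_mem_sphere hD hw (h0 x hx w hw).2
    exact absurd (Set.mk_mem_prod hu hv) (he ▸ Set.notMem_empty _)
  · obtain ⟨⟨u₀, v₀⟩, ⟨hu₀, hv₀⟩, hmin⟩ := (hCc.prod hDc).exists_isMinOn hne
      (f := fun p : E × E => ‖inner 𝕜 p.2 p.1‖) (by fun_prop)
    refine ⟨‖inner 𝕜 v₀ u₀‖, norm_pos_iff.2 (h _ hu₀.1 _ hv₀.1), fun x hx w hw => ?_⟩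
    obtain ⟨u, hu, hxu⟩ := exists_smul_mem_sphere hC hx (h0 x hx w hw).1
    obtain ⟨v, hv, hwv⟩ := exists_smul_mem_sphere hD hw (h0 x hx w hw).2
    have := isMinOn_iff.1 hmin (u, v) ⟨hu, hv⟩
    have e : ‖inner 𝕜 w x‖ = ‖inner 𝕜 v u‖ * ‖w‖ * ‖x‖ := by
      conv_lhs => rw [hxu, hwv]
      simp only [inner_smul_left, inner_smul_right, norm_mul, RCLike.norm_conj,
        RCLike.norm_ofReal, abs_norm]
      ring
    rw [e]
    gcongr

/-- A linear map sending a cone with compact base into an open cone leaves room around the image,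
proportionally to the size of the vector. -/
theorem exists_margin [FiniteDimensional 𝕜 E] {C D : Set E}
    (hC : ∀ c : 𝕜, c ≠ 0 → ∀ x ∈ C, c • x ∈ C)
    (hD : ∀ c : 𝕜, c ≠ 0 → ∀ x ∈ D, c • x ∈ D) (hC0 : (0 : E) ∉ C)
    (hCc : IsCompact (C ∩ Metric.sphere 0 1)) (hDo : IsOpen D) (T : E →ₗ[𝕜] E)
    (hT : ∀ x ∈ C, T x ∈ D) :
    ∃ δ, 0 < δ ∧ ∀ x ∈ C, ∀ z, ‖z‖ ≤ δ * ‖T x‖ → T x + z ∈ D := by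
  have hTc : Continuous T := T.continuous_of_finiteDimensional
  obtain ⟨δ, hδ, hsub⟩ := (hCc.image hTc).exists_cthickening_subset_open hDo
    (by rintro _ ⟨x, hx, rfl⟩; exact hT x hx.1)
  obtain ⟨K, hK, hTK⟩ := T.toContinuousLinearMap.bound
  refine ⟨δ / K, by positivity, fun x hx z hz => ?_⟩
  have hx0 : x ≠ 0 := fun e => hC0 (e ▸ hx)
  obtain ⟨u, hu, hxu⟩ := exists_smul_mem_sphere hC hx hx0
  have hn : (‖x‖ : 𝕜) ≠ 0 := by simpa using hx0
  have hn' : 0 < ‖x‖ := norm_pos_iff.2 hx0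
  have hz' : ‖z‖ ≤ δ * ‖x‖ := by
    refine hz.trans ?_
    have := hTK x
    rw [LinearMap.coe_toContinuousLinearMap'] at this
    calc δ / K * ‖T x‖ ≤ δ / K * (K * ‖x‖) := by gcongr
      _ = δ * ‖x‖ := by field_simp
  have hmem : T u + (‖x‖ : 𝕜)⁻¹ • z ∈ D := by
    apply hsub
    refine Metric.mem_cthickening_of_dist_le _ (T u) _ _ ⟨u, hu, rfl⟩ ?_
    rw [dist_eq_norm, add_sub_cancel_left, norm_smul, norm_inv, RCLike.norm_ofReal, abs_norm,
      inv_mul_le_iff₀ hn', mul_comm]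
    exact hz'
  have := hD _ hn _ hmem
  rwa [smul_add, smul_inv_smul₀ hn, ← map_smul, ← hxu] at this

/-- An open cone contains a ball, of radius proportional to the norm of its center. -/
theorem exists_ball_subset {D : Set E} (hDo : IsOpen D) (hne : D.Nonempty) (h0 : (0 : E) ∉ D) :
    ∃ δ, 0 < δ ∧ ∃ x ∈ D, ∀ z, ‖z‖ ≤ δ * ‖x‖ → x + z ∈ D := by
  obtain ⟨x, hx⟩ := hne
  have hx0 : 0 < ‖x‖ := norm_pos_iff.2 fun e => h0 (e ▸ hx)
  obtain ⟨r, hr, hball⟩ := Metric.isOpen_iff.1 hDo x hx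
  refine ⟨r / 2 / ‖x‖, by positivity, x, hx, fun z hz => hball ?_⟩
  rw [div_mul_cancel₀ _ hx0.ne'] at hz
  rw [Metric.mem_ball, dist_eq_norm, add_sub_cancel_left]
  linarith

end Compactness

/-! ### Cone systems -/

section ConeSystem

variable {𝕜 : Type*} [RCLike 𝕜] {d : ℕ}

/-- Ping-pong position in terms of vectors: `A i` is the cone of vectors over `U i`, and `B i` the
cone of normal vectors of the hyperplanes in `V i`, so that `γ⁻¹` acts on `B i` through the adjoint
of `γ`. The constant `ε` measures the transversality, and `δ` the size of balls contained in the
cones. -/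
structure IsConeSystem (Γ : Fin 2 → Subsemigroup (GL (Fin d) 𝕜))
    (A B : Fin 2 → Set (EuclideanSpace 𝕜 (Fin d))) (ε δ : ℝ) : Prop where
  eps_pos : 0 < ε
  delta_pos : 0 < δ
  ne_zero_left : ∀ i, ∀ x ∈ A i, x ≠ 0
  ne_zero_right : ∀ i, ∀ w ∈ B i, w ≠ 0
  ball_left : ∀ i, ∃ x ∈ A i, ∀ z, ‖z‖ ≤ δ * ‖x‖ → x + z ∈ A i
  ball_right : ∀ i, ∃ w ∈ B i, ∀ z, ‖z‖ ≤ δ * ‖w‖ → w + z ∈ B i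
  transverse : ∀ i j, i ≠ j → ∀ x ∈ A i, ∀ w ∈ B j, ε * ‖w‖ * ‖x‖ ≤ ‖inner 𝕜 w x‖
  map_left : ∀ i j, i ≠ j → ∀ γ ∈ Γ i, γ ≠ 1 → ∀ x ∈ A j, lin γ x ∈ A i
  map_right : ∀ i j, i ≠ j → ∀ γ ∈ Γ i, γ ≠ 1 → ∃ η, 0 < η ∧ ∀ w ∈ B j, ∀ z,
    ‖z‖ ≤ η * ‖LinearMap.adjoint (lin γ) w‖ → LinearMap.adjoint (lin γ) w + z ∈ B i

theorem InPingPongPosition.exists_isConeSystem {Γ : Fin 2 → Subsemigroup (GL (Fin d) 𝕜)}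
    {U : Fin 2 → Set (ℙ 𝕜 (EuclideanSpace 𝕜 (Fin d)))} {V : Fin 2 → Set (Hyperplane 𝕜 d)}
    (hpp : InPingPongPosition Γ U V) (hU : ∀ i, (U i).Nonempty) (hV : ∀ i, (V i).Nonempty) :
    ∃ A B ε δ, IsConeSystem Γ A B ε δ := by
  have ht : ∀ i j, ∃ ε, 0 < ε ∧ (i ≠ j → ∀ x ∈ pointCone (closure (U i)),
      ∀ w ∈ normalCone (closure (V j)), ε * ‖w‖ * ‖x‖ ≤ ‖inner 𝕜 w x‖) := by
    intro i j
    by_cases hij : i = j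
    · exact ⟨1, one_pos, fun h => absurd hij h⟩
    · obtain ⟨ε, hε, h⟩ := exists_uniform_transversality (𝕜 := 𝕜)
        (fun c hc x hx => smul_mem_pointCone hc hx) (fun c hc x hx => smul_mem_normalCone hc hx)
        (isCompact_pointCone_inter_sphere (isClosed_closure (s := U i)))
        (isCompact_normalCone_inter_sphere (isClosed_closure (s := V j)))
        (fun x ⟨hx0, hx⟩ w ⟨hw0, hw⟩ =>
          inner_ne_zero_of_transverse hx0 hw0 (hpp.transverse i j hij _ hx _ hw))
      exact ⟨ε, hε, fun _ => h⟩
  choose f hf hft using ht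
  have hA : ∀ i, ∃ δ, 0 < δ ∧ ∃ x ∈ pointCone (U i), ∀ z, ‖z‖ ≤ δ * ‖x‖ →
      x + z ∈ pointCone (U i) := fun i => exists_ball_subset
    (isOpen_pointCone (hpp.isOpen_points i)) (pointCone_nonempty (hU i)) fun h => h.1 rfl
  have hB : ∀ i, ∃ δ, 0 < δ ∧ ∃ x ∈ normalCone (V i), ∀ z, ‖z‖ ≤ δ * ‖x‖ →
      x + z ∈ normalCone (V i) := fun i => exists_ball_subset
    (isOpen_normalCone (hpp.isOpen_hyperplanes i)) (normalCone_nonempty (hV i)) fun h => h.1 rfl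
  choose a ha x hx hxa using hA
  choose b hb y hy hyb using hB
  obtain ⟨ε, hε, hεf⟩ := exists_pos_le_of_finite (fun p : Fin 2 × Fin 2 => f p.1 p.2)
    fun p => hf p.1 p.2
  obtain ⟨δ, hδ, hδab⟩ := exists_pos_le_of_finite (fun i => min (a i) (b i))
    fun i => lt_min (ha i) (hb i)
  refine ⟨fun i => pointCone (U i), fun i => normalCone (V i), ε, δ, hε, hδ,
    fun i x hx => hx.1, fun i x hx => hx.1, fun i => ⟨x i, hx i, fun z hz => hxa i z ?_⟩,
    fun i => ⟨y i, hy i, fun z hz => hyb i z ?_⟩, ?_, ?_, ?_⟩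
  · exact hz.trans (mul_le_mul_of_nonneg_right ((hδab i).trans (min_le_left _ _)) (norm_nonneg _))
  · exact hz.trans (mul_le_mul_of_nonneg_right ((hδab i).trans (min_le_right _ _)) (norm_nonneg _))
  · intro i j hij x hx w hw
    refine le_trans ?_ (hft i j hij x (pointCone_mono subset_closure hx) w
      (normalCone_mono subset_closure hw))
    have := hεf (i, j)
    gcongr
  · intro i j hij γ hγ hγ1 x hx
    exact lin_mem_pointCone (hpp.map_points i j hij γ hγ hγ1) (pointCone_mono subset_closure hx)
  · intro i j hij γ hγ hγ1
    -- The room comes from the closure of `V j`, whose cone has a compact base.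
    obtain ⟨η, hη, h⟩ := exists_margin (𝕜 := 𝕜) (fun c hc x hx => smul_mem_normalCone hc hx)
      (fun c hc x hx => smul_mem_normalCone hc hx) (fun h => h.1 rfl)
      (isCompact_normalCone_inter_sphere (isClosed_closure (s := V j)))
      (isOpen_normalCone (hpp.isOpen_hyperplanes i)) (LinearMap.adjoint (lin γ))
      (fun w hw => adjoint_mem_normalCone (hpp.map_hyperplanes i j hij γ hγ hγ1) hw)
    exact ⟨η, hη, fun w hw => h w (normalCone_mono subset_closure hw)⟩

end ConeSystem

/-! ### An infinitesimal Hilbert metric -/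

section CrossBound

variable {𝕜 : Type*} [RCLike 𝕜] {d : ℕ}

/-- `M` bounds the norm of the tangent vector `y` at the line of `x` in the infinitesimal Hilbert
metric defined by `B`, that is, the diameter of the set of the logarithmic derivatives at `x`,
in the direction `y`, of the linear forms `⟪q, ·⟫` with `q ∈ B`. -/
def CrossBound (B : Set (EuclideanSpace 𝕜 (Fin d))) (x y : EuclideanSpace 𝕜 (Fin d))
    (M : ℝ) : Prop :=
  ∀ p ∈ B, ∀ q ∈ B, ‖inner 𝕜 q y / inner 𝕜 q x - inner 𝕜 p y / inner 𝕜 p x‖ ≤ M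

theorem exists_inner_add_smul_eq_zero {x : EuclideanSpace 𝕜 (Fin d)} (hx : x ≠ 0)
    (y : EuclideanSpace 𝕜 (Fin d)) : ∃ c : 𝕜, inner 𝕜 x (y + c • x) = 0 := by
  have h : inner 𝕜 x x ≠ 0 := inner_self_ne_zero.2 hx
  refine ⟨-(inner 𝕜 x y / inner 𝕜 x x), ?_⟩
  rw [inner_add_right, inner_smul_right, neg_mul, div_mul_cancel₀ _ h, add_neg_cancel]

/-- The logarithmic derivatives in the directions `y` and `y + c • x` differ by the constant `c`. -/
theorem inner_add_smul_div {x y q : EuclideanSpace 𝕜 (Fin d)} (c : 𝕜) (h : inner 𝕜 q x ≠ 0) :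
    inner 𝕜 q (y + c • x) / inner 𝕜 q x = inner 𝕜 q y / inner 𝕜 q x + c := by
  rw [inner_add_right, inner_smul_right, add_div, mul_div_cancel_right₀ _ h]

theorem inner_ne_zero_of_le {x q : EuclideanSpace 𝕜 (Fin d)} {ε : ℝ} (hε : 0 < ε) (hx : x ≠ 0)
    (hq : q ≠ 0) (h : ε * ‖q‖ * ‖x‖ ≤ ‖inner 𝕜 q x‖) : inner 𝕜 q x ≠ 0 := by
  have h1 := norm_pos_iff.2 hx
  have h2 := norm_pos_iff.2 hq
  exact norm_pos_iff.1 (lt_of_lt_of_le (by positivity) h)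

/-- The infinitesimal Hilbert metric is bounded by the angular metric. -/
theorem crossBound_wedge {B : Set (EuclideanSpace 𝕜 (Fin d))} {x : EuclideanSpace 𝕜 (Fin d)}
    {ε : ℝ} (hε : 0 < ε) (hx : x ≠ 0) (hB0 : ∀ w ∈ B, w ≠ 0)
    (hB : ∀ w ∈ B, ε * ‖w‖ * ‖x‖ ≤ ‖inner 𝕜 w x‖) (y : EuclideanSpace 𝕜 (Fin d)) :
    CrossBound B x y (2 / ε * (‖wedge x y‖ / ‖x‖ ^ 2)) := by
  obtain ⟨c, hc⟩ := exists_inner_add_smul_eq_zero hx y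
  have hx' := norm_pos_iff.2 hx
  have key : ∀ q ∈ B, ‖inner 𝕜 q (y + c • x) / inner 𝕜 q x‖ ≤
      1 / ε * (‖wedge x y‖ / ‖x‖ ^ 2) := by
    intro q hq
    have hq' := norm_pos_iff.2 (hB0 q hq)
    have hw := mul_norm_le_norm_wedge hc
    rw [wedge_add_smul_right] at hw
    rw [norm_div]
    calc ‖inner 𝕜 q (y + c • x)‖ / ‖inner 𝕜 q x‖
        ≤ (‖q‖ * ‖y + c • x‖) / (ε * ‖q‖ * ‖x‖) := by
          gcongr
          · exact norm_inner_le_norm _ _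
          · exact hB q hq
      _ = 1 / ε * ((‖x‖ * ‖y + c • x‖) / ‖x‖ ^ 2) := by field_simp
      _ ≤ _ := by gcongr
  intro p hp q hq
  have h1 := inner_add_smul_div (y := y) c (inner_ne_zero_of_le hε hx (hB0 q hq) (hB q hq))
  have h2 := inner_add_smul_div (y := y) c (inner_ne_zero_of_le hε hx (hB0 p hp) (hB p hp))
  calc _ = ‖inner 𝕜 q (y + c • x) / inner 𝕜 q x - inner 𝕜 p (y + c • x) / inner 𝕜 p x‖ := by
        rw [h1, h2, add_sub_add_right_eq_sub]
    _ ≤ _ := norm_sub_le _ _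
    _ ≤ 1 / ε * (‖wedge x y‖ / ‖x‖ ^ 2) + 1 / ε * (‖wedge x y‖ / ‖x‖ ^ 2) :=
        add_le_add (key q hq) (key p hp)
    _ = _ := by ring

/-- If a ball around `q` is contained in `B`, then the logarithmic derivatives of the forms in `B`
fill a disc around that of `q`, so that a bound for their diameter has room to spare at `q`. -/
theorem CrossBound.norm_sub_add_le {B : Set (EuclideanSpace 𝕜 (Fin d))}
    {x y p q : EuclideanSpace 𝕜 (Fin d)} {M δ : ℝ} (h : CrossBound B x y M) (hδ : 0 < δ)
    (hx : x ≠ 0) (hp : p ∈ B) (hpx : inner 𝕜 p x ≠ 0) (hqx : inner 𝕜 q x ≠ 0)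
    (hball : ∀ z, ‖z‖ ≤ δ * ‖q‖ → q + z ∈ B) :
    ‖inner 𝕜 q y / inner 𝕜 q x - inner 𝕜 p y / inner 𝕜 p x‖ +
      δ / 2 * (‖wedge x y‖ / ‖x‖ ^ 2) ≤ M := by
  obtain ⟨c, hc⟩ := exists_inner_add_smul_eq_zero hx y
  set y' := y + c • x with hy'
  have hx' := norm_pos_iff.2 hx
  have hqx' := norm_pos_iff.2 hqx
  have hwedge : ‖wedge x y‖ ≤ 2 * ‖x‖ * ‖y'‖ := by
    rw [← wedge_add_smul_right c x y]
    exact norm_wedge_le _ _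
  have hshift : ∀ r : EuclideanSpace 𝕜 (Fin d), inner 𝕜 r x ≠ 0 →
      inner 𝕜 r y / inner 𝕜 r x - inner 𝕜 p y / inner 𝕜 p x =
        inner 𝕜 r y' / inner 𝕜 r x - inner 𝕜 p y' / inner 𝕜 p x := by
    intro r hr
    rw [hy', inner_add_smul_div c hr, inner_add_smul_div c hpx, add_sub_add_right_eq_sub]
  rcases eq_or_ne y' 0 with h0 | h0
  · have hw0 : ‖wedge x y‖ = 0 := le_antisymm (by simpa [h0] using hwedge) (norm_nonneg _)
    rw [hw0, zero_div, mul_zero, add_zero]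
    have := h p hp q (by simpa using hball 0 (by simpa using by positivity))
    exact this
  have hy0 := norm_pos_iff.2 h0
  set D := inner 𝕜 q y' / inner 𝕜 q x - inner 𝕜 p y' / inner 𝕜 p x with hD
  -- A unit scalar in the direction of the difference `D`.
  obtain ⟨θ, hθ, hDθ⟩ : ∃ θ : 𝕜, ‖θ‖ = 1 ∧ D = ‖D‖ * θ := by
    rcases eq_or_ne D 0 with e | e
    · exact ⟨1, norm_one, by simp [e]⟩
    · have : (‖D‖ : 𝕜) ≠ 0 := by simpa using e
      exact ⟨D / ‖D‖, by simp [e], by field_simp⟩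
  set s : ℝ := δ * ‖q‖ * ‖y'‖ / ‖inner 𝕜 q x‖ with hs
  -- The perturbation of `q` along `y'` that increases the difference by `s θ`.
  set b : 𝕜 := (s : 𝕜) * θ * inner 𝕜 q x / (‖y'‖ : 𝕜) ^ 2 with hb
  set z := (starRingEnd 𝕜 b) • y' with hz
  have hs0 : 0 ≤ s := by positivity
  have hyK : (‖y'‖ : 𝕜) ≠ 0 := by simpa using h0
  have hzn : ‖z‖ ≤ δ * ‖q‖ := by
    rw [hz, norm_smul, RCLike.norm_conj, hb, norm_div, norm_mul, norm_mul, hθ, norm_pow,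
      RCLike.norm_ofReal, RCLike.norm_ofReal, abs_norm, abs_of_nonneg hs0, hs]
    apply le_of_eq
    field_simp
  have hzx : inner 𝕜 (q + z) x = inner 𝕜 q x := by
    rw [inner_add_left, hz, inner_smul_left, inner_eq_zero_symm.1 hc, mul_zero, add_zero]
  have hzy : inner 𝕜 (q + z) y' / inner 𝕜 q x = inner 𝕜 q y' / inner 𝕜 q x + s * θ := by
    rw [inner_add_left, hz, inner_smul_left, RCLike.conj_conj, inner_self_eq_norm_sq_to_K, add_div,
      hb]
    congr 1
    field_simp
  have hfin := h p hp (q + z) (hball z hzn)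
  rw [hshift (q + z) (by rwa [hzx]), hzx, hzy] at hfin
  have e : inner 𝕜 q y' / inner 𝕜 q x + s * θ - inner 𝕜 p y' / inner 𝕜 p x =
      ((‖D‖ + s : ℝ) : 𝕜) * θ := by
    push_cast
    rw [add_mul, ← hDθ, hD]
    ring
  rw [e, norm_mul, hθ, mul_one, RCLike.norm_ofReal, abs_of_nonneg (by positivity)] at hfin
  rw [hshift q hqx]
  refine le_trans (add_le_add_right ?_ _) hfin
  calc δ / 2 * (‖wedge x y‖ / ‖x‖ ^ 2) ≤ δ / 2 * ((2 * ‖x‖ * ‖y'‖) / ‖x‖ ^ 2) := by gcongr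
    _ = δ * ‖y'‖ / ‖x‖ := by field_simp
    _ ≤ s := by
      rw [hs, div_le_div_iff₀ hx' hqx']
      have := norm_inner_le_norm (𝕜 := 𝕜) q x
      nlinarith [mul_nonneg (mul_nonneg hδ.le hy0.le) (sub_nonneg.2 this)]

end CrossBound

/-! ### The action of a letter -/

section Letters

variable {𝕜 : Type*} [RCLike 𝕜] {d : ℕ} {Γ : Fin 2 → Subsemigroup (GL (Fin d) 𝕜)}
  {A B : Fin 2 → Set (EuclideanSpace 𝕜 (Fin d))} {ε δ : ℝ}

theorem IsConeSystem.map_right_mem (h : IsConeSystem Γ A B ε δ) {i j : Fin 2} (hij : i ≠ j)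
    {γ : GL (Fin d) 𝕜} (hγ : γ ∈ Γ i) (hγ1 : γ ≠ 1) {w : EuclideanSpace 𝕜 (Fin d)}
    (hw : w ∈ B j) : LinearMap.adjoint (lin γ) w ∈ B i := by
  obtain ⟨η, hη, hm⟩ := h.map_right i j hij γ hγ hγ1
  simpa using hm w hw 0 (by simpa using by positivity)

theorem IsConeSystem.inner_ne_zero (h : IsConeSystem Γ A B ε δ) {i j : Fin 2} (hij : i ≠ j)
    {x w : EuclideanSpace 𝕜 (Fin d)} (hx : x ∈ A i) (hw : w ∈ B j) : inner 𝕜 w x ≠ 0 :=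
  inner_ne_zero_of_le h.eps_pos (h.ne_zero_left i x hx) (h.ne_zero_right j w hw)
    (h.transverse i j hij x hx w hw)

/-- A letter `γ` expands the vectors of its cone by a definite fraction of `σ₁(γ)`: the linear forms
`⟪γ† w, ·⟫` are uniformly transverse to that cone, and the vectors `w ∈ B j` span. -/
theorem IsConeSystem.le_norm_lin (h : IsConeSystem Γ A B ε δ) (hd : 2 ≤ d) {i j : Fin 2}
    (hij : i ≠ j) {γ : GL (Fin d) 𝕜} (hγ : γ ∈ Γ i) (hγ1 : γ ≠ 1)
    {x : EuclideanSpace 𝕜 (Fin d)} (hx : x ∈ A j) :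
    δ * ε / (2 + δ) * sigma 1 γ * ‖x‖ ≤ ‖lin γ x‖ := by
  have hε := h.eps_pos
  have hδ := h.delta_pos
  have hσ := sigma_pos hd (i := 1) (by norm_num) γ
  obtain ⟨w, hw, hball⟩ := h.ball_right j
  have hw0 := norm_pos_iff.2 (h.ne_zero_right j w hw)
  have key : ∀ v ∈ B j, ε * ‖LinearMap.adjoint (lin γ) v‖ * ‖x‖ ≤ ‖v‖ * ‖lin γ x‖ := by
    intro v hv
    refine (h.transverse j i hij.symm x hx _ (h.map_right_mem hij hγ hγ1 hv)).trans ?_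
    rw [LinearMap.adjoint_inner_left]
    exact norm_inner_le_norm _ _
  obtain ⟨u, -, hu, -, huσ, -⟩ := exists_singular_pair hd γ
  -- A vector of norm `δ ‖w‖` on which the adjoint of `γ` expands by at least `σ₁(γ)`.
  set z : EuclideanSpace 𝕜 (Fin d) := ((δ * ‖w‖ / sigma 1 γ : ℝ) : 𝕜) • lin γ u with hz
  have hzn : ‖z‖ = δ * ‖w‖ := by
    rw [hz, norm_smul, huσ, RCLike.norm_ofReal, abs_of_nonneg (by positivity)]
    field_simp
  have hadj : sigma 1 γ ^ 2 ≤ ‖LinearMap.adjoint (lin γ) (lin γ u)‖ := by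
    have h1 := norm_inner_le_norm (𝕜 := 𝕜) (LinearMap.adjoint (lin γ) (lin γ u)) u
    rw [LinearMap.adjoint_inner_left, hu, mul_one, inner_self_eq_norm_sq_to_K, huσ, norm_pow,
      RCLike.norm_ofReal, sq_abs] at h1
    exact h1
  have hTz : δ * ‖w‖ * sigma 1 γ ≤ ‖LinearMap.adjoint (lin γ) z‖ := by
    rw [hz, map_smul, norm_smul, RCLike.norm_ofReal, abs_of_nonneg (by positivity)]
    calc δ * ‖w‖ * sigma 1 γ = δ * ‖w‖ / sigma 1 γ * sigma 1 γ ^ 2 := by field_simp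
      _ ≤ _ := by gcongr
  have h1 := key w hw
  have h2 := key (w + z) (hball z hzn.le)
  have h3 : ‖LinearMap.adjoint (lin γ) z‖ ≤
      ‖LinearMap.adjoint (lin γ) (w + z)‖ + ‖LinearMap.adjoint (lin γ) w‖ := by
    calc _ = ‖LinearMap.adjoint (lin γ) (w + z) - LinearMap.adjoint (lin γ) w‖ := by
          rw [map_add, add_sub_cancel_left]
      _ ≤ _ := norm_sub_le _ _
  have h4 : ‖w + z‖ ≤ (1 + δ) * ‖w‖ := by
    refine (norm_add_le _ _).trans (le_of_eq ?_)
    rw [hzn]; ring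
  have h5 : ‖w‖ * (δ * ε * sigma 1 γ * ‖x‖) ≤ ‖w‖ * ((2 + δ) * ‖lin γ x‖) := by
    calc ‖w‖ * (δ * ε * sigma 1 γ * ‖x‖) = ε * (δ * ‖w‖ * sigma 1 γ) * ‖x‖ := by ring
      _ ≤ ε * (‖LinearMap.adjoint (lin γ) (w + z)‖ + ‖LinearMap.adjoint (lin γ) w‖) * ‖x‖ := by
        gcongr; exact hTz.trans h3
      _ = ε * ‖LinearMap.adjoint (lin γ) (w + z)‖ * ‖x‖ +
          ε * ‖LinearMap.adjoint (lin γ) w‖ * ‖x‖ := by ring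
      _ ≤ ‖w + z‖ * ‖lin γ x‖ + ‖w‖ * ‖lin γ x‖ := add_le_add h2 h1
      _ ≤ (1 + δ) * ‖w‖ * ‖lin γ x‖ + ‖w‖ * ‖lin γ x‖ := by gcongr
      _ = _ := by ring
  have h6 := le_of_mul_le_mul_left h5 hw0
  rw [div_mul_eq_mul_div, div_mul_eq_mul_div, div_le_iff₀ (by positivity)]
  linarith

/-- In a divergent semigroup, all but finitely many elements have a large singular value gap. -/
theorem IsDivergent.finite_gap_lt {k : ℕ} {S : Subsemigroup (GL (Fin d) 𝕜)}
    (h : IsDivergent k S) (T : ℝ) : {γ | γ ∈ S ∧ sigma k γ / sigma (k + 1) γ < T}.Finite := by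
  by_contra hinf
  have hinf : {γ | γ ∈ S ∧ sigma k γ / sigma (k + 1) γ < T}.Infinite := hinf
  have ht := h (fun n => hinf.natEmbedding _ n)
    (Subtype.val_injective.comp (hinf.natEmbedding _).injective)
    (fun n => (hinf.natEmbedding _ n).2.1)
  obtain ⟨n, hn⟩ := (ht.eventually_ge_atTop T).exists
  exact absurd (hinf.natEmbedding _ n).2.2 (not_lt.2 hn)

theorem IsConeSystem.mul_wedge_le_of_crossBound (h : IsConeSystem Γ A B ε δ) {i j : Fin 2}
    (hij : i ≠ j) {x y : EuclideanSpace 𝕜 (Fin d)} (hx : x ∈ A i) {M : ℝ}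
    (hM : CrossBound (B j) x y M) : δ / 2 * (‖wedge x y‖ / ‖x‖ ^ 2) ≤ M := by
  obtain ⟨w, hw, hball⟩ := h.ball_right j
  have := h.inner_ne_zero hij hx hw
  simpa using hM.norm_sub_add_le h.delta_pos (h.ne_zero_left i x hx) hw this this hball

/-- The letters contract the infinitesimal Hilbert metrics uniformly. For the finitely many letters
with a small singular value gap this comes from the room that they leave around the image of the
normal cone; the other letters contract the angular metric by the inverse of their gap, up to a
constant, and the angular metric is equivalent to the infinitesimal Hilbert metric. -/
theorem IsConeSystem.exists_contraction (h : IsConeSystem Γ A B ε δ) (hd : 2 ≤ d)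
    (hΓ : ∀ i, IsDivergent 1 (Γ i)) {i j : Fin 2} (hij : i ≠ j) :
    ∃ κ, 0 < κ ∧ κ < 1 ∧ ∀ γ ∈ Γ i, γ ≠ 1 → ∀ x ∈ A j, ∀ y M,
      CrossBound (B i) x y M → CrossBound (B j) (lin γ x) (lin γ y) (κ * M) := by
  have hε := h.eps_pos
  have hδ := h.delta_pos
  set c := δ * ε / (2 + δ) with hc
  have hc0 : 0 < c := by positivity
  set T := 8 / (ε * c ^ 2 * δ) with hT
  have hT0 : 0 < T := by positivity
  have hfin := (hΓ i).finite_gap_lt T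
  have hfin' : ({γ | γ ∈ Γ i ∧ sigma 1 γ / sigma (1 + 1) γ < T} ∩ {γ | γ ≠ 1}).Finite :=
    hfin.inter_of_left _
  have := hfin'.to_subtype
  choose f hf hfm using fun γ : ({γ | γ ∈ Γ i ∧ sigma 1 γ / sigma (1 + 1) γ < T} ∩
    {γ | γ ≠ 1} : Set (GL (Fin d) 𝕜)) => h.map_right i j hij γ.1 γ.2.1.1 γ.2.2
  obtain ⟨η, hη, hηf⟩ := exists_pos_le_of_finite f hf
  refine ⟨max (1 / 2) (1 / (1 + η * ε / 4)), by positivity, ?_, ?_⟩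
  · refine max_lt (by norm_num) ((div_lt_one (by positivity)).2 ?_)
    linarith [show 0 < η * ε / 4 by positivity]
  intro γ hγ hγ1 x hx y M hM
  have hx0 := h.ne_zero_left j x hx
  have hxn := norm_pos_iff.2 hx0
  have hMa := h.mul_wedge_le_of_crossBound hij.symm hx hM
  have hM0 : 0 ≤ M := le_trans (by positivity) hMa
  intro p hp q hq
  by_cases hgap : sigma 1 γ / sigma 2 γ < T
  · have hp' := h.map_right_mem hij hγ hγ1 hp
    have hq' := h.map_right_mem hij hγ hγ1 hq
    rw [← LinearMap.adjoint_inner_left, ← LinearMap.adjoint_inner_left,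
      ← LinearMap.adjoint_inner_left, ← LinearMap.adjoint_inner_left]
    set p' := LinearMap.adjoint (lin γ) p
    set q' := LinearMap.adjoint (lin γ) q
    set D := ‖inner 𝕜 q' y / inner 𝕜 q' x - inner 𝕜 p' y / inner 𝕜 p' x‖
    have h1 : D + η / 2 * (‖wedge x y‖ / ‖x‖ ^ 2) ≤ M :=
      hM.norm_sub_add_le hη hx0 hp' (h.inner_ne_zero hij.symm hx hp')
        (h.inner_ne_zero hij.symm hx hq') fun z hz => hfm ⟨γ, ⟨hγ, hgap⟩, hγ1⟩ q hq z
          (hz.trans (mul_le_mul_of_nonneg_right (hηf _) (norm_nonneg _)))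
    have h2 : D ≤ 2 / ε * (‖wedge x y‖ / ‖x‖ ^ 2) :=
      crossBound_wedge hε hx0 (h.ne_zero_right i) (h.transverse j i hij.symm x hx) y _ hp' _ hq'
    have h3 : D * (1 + η * ε / 4) ≤ M := by
      have : ε / 2 * D ≤ ‖wedge x y‖ / ‖x‖ ^ 2 := by
        calc ε / 2 * D ≤ ε / 2 * (2 / ε * (‖wedge x y‖ / ‖x‖ ^ 2)) := by gcongr
          _ = _ := by field_simp
      nlinarith [mul_le_mul_of_nonneg_left this (show 0 ≤ η / 2 by positivity)]
    calc D ≤ 1 / (1 + η * ε / 4) * M := by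
          rw [one_div, inv_mul_eq_div, le_div_iff₀ (by positivity)]
          exact h3
      _ ≤ _ := mul_le_mul_of_nonneg_right (le_max_right _ _) hM0
  · have hσ1 := sigma_pos hd (i := 1) (by norm_num) γ
    have hσ2 := sigma_pos hd (i := 2) (by norm_num) γ
    have hgx := h.map_left i j hij γ hγ hγ1 x hx
    have hlow := h.le_norm_lin hd hij hγ hγ1 hx
    have h1 := crossBound_wedge hε (h.ne_zero_left i _ hgx) (h.ne_zero_right j)
      (h.transverse i j hij _ hgx) (lin γ y) _ hp _ hq
    refine h1.trans (le_trans ?_ (mul_le_mul_of_nonneg_right (le_max_left _ _) hM0))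
    have hgap' : T * sigma 2 γ ≤ sigma 1 γ := by
      rwa [not_lt, le_div_iff₀ hσ2] at hgap
    calc 2 / ε * (‖wedge (lin γ x) (lin γ y)‖ / ‖lin γ x‖ ^ 2)
        ≤ 2 / ε * ((sigma 1 γ * sigma 2 γ * ‖wedge x y‖) / (c * sigma 1 γ * ‖x‖) ^ 2) := by
          gcongr
          exact norm_wedge_lin_le γ x y
      _ = 4 / (ε * c ^ 2 * δ) * (sigma 2 γ / sigma 1 γ) * (δ / 2 * (‖wedge x y‖ / ‖x‖ ^ 2)) := by
          field_simp; ring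
      _ ≤ 4 / (ε * c ^ 2 * δ) * (1 / T) * M := by
          gcongr ?_ * ?_ * ?_
          rw [div_le_div_iff₀ hσ1 hT0]
          linarith
      _ = 1 / 2 * M := by
          rw [hT]; field_simp; ring

end Letters

/-! ### Reduced words -/

section Words

variable {𝕜 : Type*} [RCLike 𝕜] {d : ℕ} {Γ : Fin 2 → Subsemigroup (GL (Fin d) 𝕜)}
  {A B : Fin 2 → Set (EuclideanSpace 𝕜 (Fin d))} {ε δ : ℝ}

/-- `Alternating Γ i k w` says that `w` is an alternating word of nontrivial letters, possibly
empty, whose first letter is taken from `Γ i`, and whose last letter is not taken from `Γ k`; in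
ping-pong position, its product maps the cone `A k` to `A i`. -/
inductive Alternating (Γ : Fin 2 → Subsemigroup (GL (Fin d) 𝕜)) :
    Fin 2 → Fin 2 → List (GL (Fin d) 𝕜) → Prop
  | nil (i : Fin 2) : Alternating Γ i i []
  | cons {i j k : Fin 2} {γ : GL (Fin d) 𝕜} {w : List (GL (Fin d) 𝕜)} (hij : i ≠ j)
      (hγ : γ ∈ Γ i) (hγ1 : γ ≠ 1) (hw : Alternating Γ j k w) : Alternating Γ i k (γ :: w)

theorem Alternating.even_length_iff {i k : Fin 2} {w : List (GL (Fin d) 𝕜)}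
    (h : Alternating Γ i k w) : Even w.length ↔ i = k := by
  induction h with
  | nil => simp
  | cons hij _ _ _ ih =>
    rw [List.length_cons, Nat.even_add_one, ih]
    omega

theorem IsReducedWord.exists_alternating {w : List (GL (Fin d) 𝕜)} (hw : IsReducedWord Γ w) :
    ∃ i k, Alternating Γ i k w := by
  obtain ⟨hlen, h1, s, hs, hs'⟩ := hw
  have key : ∀ w : List (GL (Fin d) 𝕜), (∀ γ ∈ w, γ ≠ 1) → ∀ s : Fin w.length → Fin 2,
      (∀ k, w.get k ∈ Γ (s k)) → (∀ k l : Fin w.length, (k : ℕ) + 1 = l → s k ≠ s l) →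
      ∀ i, (∀ k : Fin w.length, (k : ℕ) = 0 → s k = i) → ∃ k, Alternating Γ i k w := by
    intro w
    induction w with
    | nil => exact fun _ _ _ _ i _ => ⟨i, .nil i⟩
    | cons γ w ih =>
      intro h1 s hs hs' i hi
      have hi0 : s ⟨0, by simp⟩ = i := hi _ rfl
      obtain ⟨k, hk⟩ := ih (fun γ' h => h1 γ' (List.mem_cons_of_mem _ h)) (fun k => s k.succ)
        (fun k => hs k.succ) (fun k l hkl => hs' _ _ (by simpa using hkl)) (i + 1)
        (fun k hk => by
          have := hs' ⟨0, by simp⟩ k.succ (by simp [hk])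
          rw [hi0] at this
          omega)
      refine ⟨k, .cons (by omega) ?_ (h1 γ List.mem_cons_self) hk⟩
      have := hs ⟨0, by simp⟩
      rwa [hi0] at this
  obtain ⟨k, hk⟩ := key w h1 s hs hs' (s ⟨0, by omega⟩) fun k hk => congrArg s (Fin.ext hk)
  exact ⟨_, k, hk⟩

theorem IsConeSystem.lin_prod_mem (h : IsConeSystem Γ A B ε δ) {i k : Fin 2}
    {w : List (GL (Fin d) 𝕜)} (hw : Alternating Γ i k w) {x : EuclideanSpace 𝕜 (Fin d)}
    (hx : x ∈ A k) : lin w.prod x ∈ A i := by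
  induction hw with
  | nil => simpa [lin_one_apply] using hx
  | cons hij hγ hγ1 _ ih =>
    rw [List.prod_cons, lin_mul_apply]
    exact h.map_left _ _ hij _ hγ hγ1 _ (ih hx)

theorem IsConeSystem.le_norm_lin_prod (h : IsConeSystem Γ A B ε δ) (hd : 2 ≤ d) {i k : Fin 2}
    {w : List (GL (Fin d) 𝕜)} (hw : Alternating Γ i k w) {x : EuclideanSpace 𝕜 (Fin d)}
    (hx : x ∈ A k) :
    (δ * ε / (2 + δ)) ^ w.length * (w.map fun γ => sigma 1 γ).prod * ‖x‖ ≤ ‖lin w.prod x‖ := by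
  have hε := h.eps_pos
  have hδ := h.delta_pos
  induction hw with
  | nil => simp [lin_one_apply]
  | @cons i j k γ w hij hγ hγ1 hw ih =>
    rw [List.prod_cons, lin_mul_apply, List.map_cons, List.prod_cons, List.length_cons]
    refine le_trans ?_ (h.le_norm_lin hd hij hγ hγ1 (h.lin_prod_mem hw hx))
    have := sigma_nonneg 1 γ
    calc _ = δ * ε / (2 + δ) * sigma 1 γ *
          ((δ * ε / (2 + δ)) ^ w.length * (w.map fun γ => sigma 1 γ).prod * ‖x‖) := by ring
      _ ≤ _ := mul_le_mul_of_nonneg_left (ih hx) (by positivity)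

theorem IsConeSystem.crossBound_lin_prod (h : IsConeSystem Γ A B ε δ) {κ : ℝ}
    (hκ : ∀ i j, i ≠ j → ∀ γ ∈ Γ i, γ ≠ 1 → ∀ x ∈ A j, ∀ y M,
      CrossBound (B i) x y M → CrossBound (B j) (lin γ x) (lin γ y) (κ * M))
    {i k : Fin 2} {w : List (GL (Fin d) 𝕜)} (hw : Alternating Γ i k w)
    {x y : EuclideanSpace 𝕜 (Fin d)} (hx : x ∈ A k) {M : ℝ}
    (hM : ∀ l, l ≠ k → CrossBound (B l) x y M) :
    ∀ l, l ≠ i → CrossBound (B l) (lin w.prod x) (lin w.prod y) (κ ^ w.length * M) := by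
  induction hw with
  | nil => simpa [lin_one_apply] using hM
  | @cons i j k γ w hij hγ hγ1 hw ih =>
    intro l hl
    obtain rfl : l = j := by omega
    rw [List.prod_cons, lin_mul_apply, lin_mul_apply, List.length_cons, pow_succ', mul_assoc]
    exact hκ i l hij γ hγ hγ1 _ (h.lin_prod_mem hw hx) _ _ (ih hx hM i hij)

/-- Exponential growth of the singular value gap along alternating words. -/
theorem IsConeSystem.exists_gap_growth (h : IsConeSystem Γ A B ε δ) (hd : 2 ≤ d)
    (hΓ : ∀ i, IsDivergent 1 (Γ i)) :
    ∃ C lam : ℝ, 0 < C ∧ 1 < lam ∧ ∀ i k w, Alternating Γ i k w →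
      C * lam ^ w.length ≤ sigma 1 w.prod / sigma 2 w.prod := by
  have hε := h.eps_pos
  have hδ := h.delta_pos
  obtain ⟨κ₀, hκ₀, hκ₀1, hc₀⟩ := h.exists_contraction hd hΓ (i := 0) (j := 1) (by decide)
  obtain ⟨κ₁, hκ₁, hκ₁1, hc₁⟩ := h.exists_contraction hd hΓ (i := 1) (j := 0) (by decide)
  set κ := max κ₀ κ₁
  have hκ0 : 0 < κ := lt_max_of_lt_left hκ₀
  have hκ1 : κ < 1 := max_lt hκ₀1 hκ₁1
  have hκ : ∀ i j, i ≠ j → ∀ γ ∈ Γ i, γ ≠ 1 → ∀ x ∈ A j, ∀ y M,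
      CrossBound (B i) x y M → CrossBound (B j) (lin γ x) (lin γ y) (κ * M) := by
    intro i j hij γ hγ hγ1 x hx y M hM
    have hM0 : 0 ≤ M :=
      le_trans (by positivity) (h.mul_wedge_le_of_crossBound hij.symm hx hM)
    fin_cases i <;> fin_cases j
    · exact absurd rfl hij
    · exact fun p hp q hq => (hc₀ γ hγ hγ1 x hx y M hM p hp q hq).trans
        (mul_le_mul_of_nonneg_right (le_max_left _ _) hM0)
    · exact fun p hp q hq => (hc₁ γ hγ hγ1 x hx y M hM p hp q hq).trans
        (mul_le_mul_of_nonneg_right (le_max_right _ _) hM0)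
    · exact absurd rfl hij
  -- On vectors of the cone, the word contracts the angular metric.
  have hang : ∀ i k w, Alternating Γ i k w → ∀ x ∈ A k, ∀ y,
      ‖wedge (lin w.prod x) (lin w.prod y)‖ ≤
        4 / (ε * δ) * κ ^ w.length * sigma 1 w.prod ^ 2 * ‖wedge x y‖ := by
    intro i k w hw x hx y
    have hx0 := norm_pos_iff.2 (h.ne_zero_left k x hx)
    have hgx := h.lin_prod_mem hw hx
    have hgx0 := norm_pos_iff.2 (h.ne_zero_left i _ hgx)
    have hM := h.crossBound_lin_prod hκ hw hx (y := y) fun l hl =>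
      crossBound_wedge hε (h.ne_zero_left k x hx) (h.ne_zero_right l)
        (h.transverse k l hl.symm x hx) y
    have h1 := h.mul_wedge_le_of_crossBound (show i ≠ i + 1 by omega) hgx
      (hM (i + 1) (by omega))
    set W := ‖wedge (lin w.prod x) (lin w.prod y)‖
    calc W = 2 / δ * ‖lin w.prod x‖ ^ 2 * (δ / 2 * (W / ‖lin w.prod x‖ ^ 2)) := by field_simp
      _ ≤ 2 / δ * ‖lin w.prod x‖ ^ 2 *
          (κ ^ w.length * (2 / ε * (‖wedge x y‖ / ‖x‖ ^ 2))) := by gcongr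
      _ ≤ 2 / δ * (sigma 1 w.prod * ‖x‖) ^ 2 *
          (κ ^ w.length * (2 / ε * (‖wedge x y‖ / ‖x‖ ^ 2))) := by
          gcongr
          exact norm_lin_le _ _
      _ = _ := by field_simp; ring
  -- The cone contains a ball, so the same holds for the singular vectors, up to a constant.
  set K := 4 / (ε * δ) * ((2 + δ) * 2 / δ) with hK
  have hK0 : 0 < K := by positivity
  refine ⟨K⁻¹, κ⁻¹, inv_pos.2 hK0, (one_lt_inv₀ hκ0).2 hκ1, fun i k w hw => ?_⟩
  obtain ⟨u, v, hu, hv, -, huv⟩ := exists_singular_pair hd w.prod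
  have hσ1 := sigma_pos hd (i := 1) (by norm_num) w.prod
  have hσ2 := sigma_pos hd (i := 2) (by norm_num) w.prod
  obtain ⟨x, hx, hball⟩ := h.ball_left k
  have hx0 := norm_pos_iff.2 (h.ne_zero_left k x hx)
  set z : EuclideanSpace 𝕜 (Fin d) := ((δ * ‖x‖ : ℝ) : 𝕜) • u with hz
  have hzn : ‖z‖ = δ * ‖x‖ := by
    rw [hz, norm_smul, hu, mul_one, RCLike.norm_ofReal, abs_of_nonneg (by positivity)]
  set Q := 4 / (ε * δ) * κ ^ w.length * sigma 1 w.prod ^ 2 with hQ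
  have hQ0 : 0 < Q := by positivity
  have h1 : δ * ‖x‖ * ‖wedge (lin w.prod u) (lin w.prod v)‖ ≤ Q * (2 * ((2 + δ) * ‖x‖)) := by
    calc δ * ‖x‖ * ‖wedge (lin w.prod u) (lin w.prod v)‖
        = ‖wedge (lin w.prod (x + z)) (lin w.prod v) - wedge (lin w.prod x) (lin w.prod v)‖ := by
          rw [← wedge_sub_left, ← map_sub, add_sub_cancel_left, hz, map_smul, wedge_smul_left,
            norm_smul, RCLike.norm_ofReal, abs_of_nonneg (by positivity)]
      _ ≤ ‖wedge (lin w.prod (x + z)) (lin w.prod v)‖ + ‖wedge (lin w.prod x) (lin w.prod v)‖ :=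
          norm_sub_le _ _
      _ ≤ Q * ‖wedge (x + z) v‖ + Q * ‖wedge x v‖ :=
          add_le_add (hang i k w hw _ (hball z hzn.le) v) (hang i k w hw x hx v)
      _ ≤ Q * (2 * ‖x + z‖ * ‖v‖) + Q * (2 * ‖x‖ * ‖v‖) := by
          gcongr <;> exact norm_wedge_le _ _
      _ ≤ Q * (2 * (‖x‖ + δ * ‖x‖) * 1) + Q * (2 * ‖x‖ * 1) := by
          rw [hv]
          gcongr
          exact (norm_add_le _ _).trans_eq (by rw [hzn])
      _ = _ := by ring
  have h2 : δ * ‖x‖ * (sigma 1 w.prod * sigma 2 w.prod) ≤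
      δ * ‖x‖ * (K * κ ^ w.length * sigma 1 w.prod ^ 2) := by
    refine (mul_le_mul_of_nonneg_left huv (by positivity)).trans (h1.trans_eq ?_)
    rw [hQ, hK]
    field_simp
  have h3 := le_of_mul_le_mul_left h2 (by positivity)
  have h4 : sigma 2 w.prod ≤ K * κ ^ w.length * sigma 1 w.prod := by
    refine le_of_mul_le_mul_left ?_ hσ1
    linarith
  rw [le_div_iff₀ hσ2, inv_pow]
  calc K⁻¹ * (κ ^ w.length)⁻¹ * sigma 2 w.prod
      ≤ K⁻¹ * (κ ^ w.length)⁻¹ * (K * κ ^ w.length * sigma 1 w.prod) := by gcongr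
    _ = sigma 1 w.prod := by field_simp

end Words

/-! ### Moduli of eigenvalues -/

section Eigenvalues

/-- Two roots of the characteristic polynomial, counted with multiplicity, are the eigenvalues of
`T` on some invariant plane. -/
theorem exists_triangular_pair {K V : Type*} [Field K] [AddCommGroup V] [Module K V]
    [FiniteDimensional K V] (T : Module.End K V) {l m : K} (h : {l, m} ≤ T.charpoly.roots) :
    ∃ x y : V, ∃ a : K, x ≠ 0 ∧ y ∉ K ∙ x ∧ T x = l • x ∧ T y = m • y + a • x := by
  have hroot : ∀ r ∈ T.charpoly.roots, ∃ x, x ≠ 0 ∧ T x = r • x := by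
    intro r hr
    obtain ⟨x, hx⟩ := ((T.hasEigenvalue_iff_isRoot_charpoly r).2
      (Polynomial.isRoot_of_mem_roots hr)).exists_hasEigenvector
    exact ⟨x, hx.2, hx.apply_eq_smul⟩
  obtain ⟨x, hx0, hx⟩ := hroot l (Multiset.mem_of_le h (by simp))
  rcases eq_or_ne l m with rfl | hlm
  · -- A double root: follow a Jordan chain of the generalized eigenspace down to the line of `x`.
    have hfin : 2 ≤ Module.finrank K (T.maxGenEigenspace l) := by
      classical
      rw [LinearMap.finrank_maxGenEigenspace_eq, ← Polynomial.count_roots]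
      simpa using Multiset.count_le_of_le l h
    obtain ⟨z, hz, hzx⟩ : ∃ z ∈ T.maxGenEigenspace l, z ∉ K ∙ x := by
      by_contra! hcon
      have := Submodule.finrank_mono (show T.maxGenEigenspace l ≤ K ∙ x from hcon)
      rw [finrank_span_singleton hx0] at this
      omega
    obtain ⟨n, hn⟩ := (T.mem_maxGenEigenspace l z).1 hz
    classical
    have hex : ∃ n, ((T - l • (1 : Module.End K V)) ^ n) z ∈ K ∙ x := ⟨n, hn ▸ Submodule.zero_mem _⟩
    obtain ⟨k, hk⟩ : ∃ k, Nat.find hex = k + 1 := by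
      refine Nat.exists_eq_succ_of_ne_zero fun h0 => hzx ?_
      simpa [h0] using Nat.find_spec hex
    have h1 := Nat.find_spec hex
    have h2 := Nat.find_min hex (show k < Nat.find hex by omega)
    rw [hk, pow_succ', Module.End.mul_apply] at h1
    obtain ⟨a, ha⟩ := Submodule.mem_span_singleton.1 h1
    refine ⟨x, ((T - l • (1 : Module.End K V)) ^ k) z, a, hx0, h2, hx, ?_⟩
    rw [ha]
    simp
  · obtain ⟨y, hy0, hy⟩ := hroot m (Multiset.mem_of_le h (by simp))
    refine ⟨x, y, 0, hx0, fun hyx => ?_, hx, by simpa using hy⟩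
    obtain ⟨c, rfl⟩ := Submodule.mem_span_singleton.1 hyx
    rw [map_smul, hx, smul_comm, ← sub_eq_zero, ← sub_smul, smul_eq_zero, sub_eq_zero] at hy
    exact hy.elim hlm hy0

theorem le_of_forall_pow_le_mul_pow {a b C : ℝ} (hb : 0 < b)
    (h : ∀ k : ℕ, a ^ k ≤ C * b ^ k) : a ≤ b := by
  by_contra! hab
  obtain ⟨k, hk⟩ := pow_unbounded_of_one_lt C ((one_lt_div hb).2 hab)
  rw [div_pow, lt_div_iff₀ (by positivity)] at hk
  exact absurd (h k) (not_le.2 hk)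

variable {𝕜 : Type*} [RCLike 𝕜] {d : ℕ}

theorem wedge_ne_zero {x y : EuclideanSpace 𝕜 (Fin d)} (hx : x ≠ 0) (hy : y ∉ 𝕜 ∙ x) :
    wedge x y ≠ 0 := by
  intro h
  obtain ⟨a, ha⟩ : ∃ a, x a ≠ 0 := by
    by_contra! h0
    exact hx (by ext a; simpa using h0 a)
  refine hy (Submodule.mem_span_singleton.2 ⟨y a / x a, ?_⟩)
  ext b
  have hab : wedge x y (a, b) = 0 := by rw [h]; rfl
  rw [wedge_apply] at hab
  simp only [PiLp.smul_apply, smul_eq_mul]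
  field_simp
  linear_combination -hab

theorem norm_toComplex (z : 𝕜) : ‖toComplex z‖ = ‖z‖ := by
  rw [← sq_eq_sq₀ (norm_nonneg _) (norm_nonneg _), Complex.sq_norm, Complex.normSq_apply,
    ← RCLike.normSq_eq_def', RCLike.normSq_apply]
  rfl

/-- The invertible complex matrix with the same entries as `g`. -/
def complexify (g : GL (Fin d) 𝕜) : GL (Fin d) ℂ :=
  Matrix.GeneralLinearGroup.map toComplex g

/-- The complex vector with the same coordinates as `x`. -/
def complexifyVec (x : EuclideanSpace 𝕜 (Fin d)) : EuclideanSpace ℂ (Fin d) :=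
  WithLp.toLp 2 fun a => toComplex (x a)

theorem norm_complexifyVec (x : EuclideanSpace 𝕜 (Fin d)) : ‖complexifyVec x‖ = ‖x‖ := by
  simp [complexifyVec, EuclideanSpace.norm_eq, norm_toComplex]

theorem lin_apply (g : GL (Fin d) 𝕜) (x : EuclideanSpace 𝕜 (Fin d)) (a : Fin d) :
    lin g x a = ∑ c, (g : Matrix (Fin d) (Fin d) 𝕜) a c * x c := by
  simp [lin, Matrix.mulVec, dotProduct]

theorem complexify_val_apply (g : GL (Fin d) 𝕜) (a c : Fin d) :
    (complexify g : Matrix (Fin d) (Fin d) ℂ) a c =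
      toComplex ((g : Matrix (Fin d) (Fin d) 𝕜) a c) := rfl

theorem lin_complexify (g : GL (Fin d) 𝕜) (x : EuclideanSpace 𝕜 (Fin d)) :
    lin (complexify g) (complexifyVec x) = complexifyVec (lin g x) := by
  ext a
  rw [lin_apply]
  simp only [complexifyVec, complexify_val_apply, lin_apply, map_sum, map_mul]

theorem charpoly_complexify (g : GL (Fin d) 𝕜) :
    (complexify g : Matrix (Fin d) (Fin d) ℂ).charpoly =
      (g : Matrix (Fin d) (Fin d) 𝕜).charpoly.map toComplex :=
  Matrix.charpoly_map _ _

theorem charpoly_lin (g : GL (Fin d) 𝕜) :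
    (lin g).charpoly = (g : Matrix (Fin d) (Fin d) 𝕜).charpoly := by
  rw [lin, Matrix.toEuclideanLin, Matrix.toLpLin_eq_toLin, Matrix.charpoly_toLin]

/-- `ell 1 g` and `ell 2 g` are the moduli of two roots of the characteristic polynomial, counted
with multiplicity, and `ell 1 g` is the largest modulus. -/
theorem exists_roots_ell (hd : 2 ≤ d) (g : GL (Fin d) 𝕜) :
    ∃ l m : ℂ, {l, m} ≤ (lin (complexify g)).charpoly.roots ∧ ell 1 g = ‖l‖ ∧ ell 2 g = ‖m‖ ∧
      ∀ r ∈ (lin (complexify g)).charpoly.roots, ‖r‖ ≤ ell 1 g := by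
  rw [charpoly_lin, charpoly_complexify]
  have hcard : (((g : Matrix (Fin d) (Fin d) 𝕜).charpoly.map toComplex).roots).card = d := by
    rw [← (IsAlgClosed.splits _).natDegree_eq_card_roots, Polynomial.natDegree_map,
      Matrix.charpoly_natDegree_eq_dim, Fintype.card_fin]
  unfold ell
  set R := ((g : Matrix (Fin d) (Fin d) 𝕜).charpoly.map toComplex).roots
  have hS : ((R.map fun z => ‖z‖).sort (· ≥ ·) : Multiset ℝ) = R.map fun z => ‖z‖ :=
    Multiset.sort_eq _ _
  have hsorted := Multiset.pairwise_sort (R.map fun z => ‖z‖) (· ≥ ·)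
  have hlen : ((R.map fun z => ‖z‖).sort (· ≥ ·)).length = d := by
    rw [Multiset.length_sort, Multiset.card_map, hcard]
  generalize (R.map fun z => ‖z‖).sort (· ≥ ·) = S at *
  match S, hlen with
  | [], h => simp at h; omega
  | [_], h => simp at h; omega
  | a :: b :: t, _ =>
    obtain ⟨l, hl, hla, ht⟩ := (Multiset.map_eq_cons _ _ _ _).2 (hS.symm.trans (Multiset.cons_coe _ _).symm)
    obtain ⟨m, hm, hmb, -⟩ := (Multiset.map_eq_cons _ _ _ _).2 (ht.trans (Multiset.cons_coe _ _).symm)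
    refine ⟨l, m, ?_, hla.symm, hmb.symm, fun r hr => ?_⟩
    · rw [← Multiset.cons_erase hl]
      exact Multiset.cons_le_cons _ (Multiset.singleton_le.2 hm)
    · have : ‖r‖ ∈ a :: b :: t := by
        rw [← Multiset.mem_coe, hS]
        exact Multiset.mem_map_of_mem _ hr
      rcases List.mem_cons.1 this with h | h
      · exact h.le
      · exact (List.pairwise_cons.1 hsorted).1 _ h

theorem ell_two_pos (hd : 2 ≤ d) (g : GL (Fin d) 𝕜) : 0 < ell 2 g := by
  obtain ⟨l, m, hlm, -, h2, -⟩ := exists_roots_ell hd g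
  rw [h2, norm_pos_iff]
  rintro rfl
  have h := Polynomial.isRoot_of_mem_roots (Multiset.mem_of_le hlm (by simp : (0 : ℂ) ∈ _))
  obtain ⟨x, hx⟩ := ((Module.End.hasEigenvalue_iff_isRoot_charpoly (lin (complexify g)) 0).2
    h).exists_hasEigenvector
  refine hx.2 (lin_injective (complexify g) ?_)
  rw [hx.apply_eq_smul, zero_smul, map_zero]

/-- If the iterates of some vector grow at rate `P`, then the spectral radius is at least `P`. -/
theorem le_ell_one (hd : 2 ≤ d) (g : GL (Fin d) 𝕜) {P : ℝ} (hP : 0 ≤ P)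
    {x : EuclideanSpace 𝕜 (Fin d)} (hx : x ≠ 0)
    (h : ∀ k : ℕ, P ^ k * ‖x‖ ≤ ‖lin (g ^ k) x‖) : P ≤ ell 1 g := by
  obtain ⟨-, -, -, -, -, hmax⟩ := exists_roots_ell hd g
  have : Nonempty (Fin d) := ⟨⟨0, by omega⟩⟩
  set T : EuclideanSpace ℂ (Fin d) →L[ℂ] EuclideanSpace ℂ (Fin d) :=
    Matrix.toEuclideanCLM (n := Fin d) (𝕜 := ℂ) (complexify g : Matrix (Fin d) (Fin d) ℂ) with hT
  have hTk : ∀ k : ℕ, (T ^ k) (complexifyVec x) = complexifyVec (lin (g ^ k) x) := by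
    intro k
    induction k with
    | zero => simp [lin_one_apply]
    | succ k ih =>
      rw [pow_succ', mul_apply_eq_comp, ih, pow_succ', lin_mul_apply,
        ← lin_complexify g]
      rfl
  have hnorm : ∀ k : ℕ, P ^ k ≤ ‖T ^ k‖ := by
    intro k
    have h1 := (T ^ k).le_opNorm (complexifyVec x)
    rw [hTk, norm_complexifyVec, norm_complexifyVec] at h1
    exact le_of_mul_le_mul_right ((h k).trans h1) (norm_pos_iff.2 hx)
  have hrad : ENNReal.ofReal P ≤ spectralRadius ℂ T := by
    refine ge_of_tendsto (spectrum.pow_norm_pow_one_div_tendsto_nhds_spectralRadius T) ?_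
    filter_upwards [eventually_ne_atTop 0] with k hk
    refine ENNReal.ofReal_le_ofReal ?_
    calc P = (P ^ k) ^ (1 / k : ℝ) := by
          rw [one_div, Real.pow_rpow_inv_natCast hP hk]
      _ ≤ _ := Real.rpow_le_rpow (pow_nonneg hP k) (hnorm k) (by positivity)
  obtain ⟨r, hr, hrT⟩ := spectrum.exists_nnnorm_eq_spectralRadius T
  have hroot : r ∈ (lin (complexify g)).charpoly.roots := by
    rw [hT, AlgEquiv.spectrum_eq, Matrix.mem_spectrum_iff_isRoot_charpoly] at hr
    rw [charpoly_lin]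
    exact (Polynomial.mem_roots (Matrix.charpoly_monic _).ne_zero).2 hr
  refine le_trans ?_ (hmax r hroot)
  rw [← hrT, ← ENNReal.ofReal_coe_nnreal, ENNReal.ofReal_le_ofReal_iff (by positivity)] at hrad
  exact hrad

/-- The `2 × 2` minors of `g` are the coordinates of the bivectors `g e_c ∧ g e_e`, and they
determine the action of `g` on bivectors (the Cauchy-Binet formula). -/
theorem two_mul_wedge_lin_apply (g : GL (Fin d) 𝕜) (x y : EuclideanSpace 𝕜 (Fin d))
    (p : Fin d × Fin d) :
    2 * wedge (lin g x) (lin g y) p =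
      ∑ c, ∑ e, ((g : Matrix (Fin d) (Fin d) 𝕜) p.1 c * (g : Matrix (Fin d) (Fin d) 𝕜) p.2 e -
        (g : Matrix (Fin d) (Fin d) 𝕜) p.2 c * (g : Matrix (Fin d) (Fin d) 𝕜) p.1 e) *
          wedge x y (c, e) := by
  simp only [wedge_apply, lin_apply, Finset.sum_mul_sum]
  rw [two_mul]
  nth_rewrite 2 [← neg_sub]
  rw [← sub_eq_add_neg]
  nth_rewrite 4 [Finset.sum_comm]
  nth_rewrite 3 [Finset.sum_comm]
  simp only [← Finset.sum_sub_distrib]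
  refine Finset.sum_congr rfl fun c _ => Finset.sum_congr rfl fun e _ => ?_
  ring

/-- The growth rate of `g` on bivectors bounds the product of the two largest moduli of
eigenvalues. -/
theorem ell_mul_ell_le (hd : 2 ≤ d) (g : GL (Fin d) 𝕜) {Q : ℝ} (hQ : 0 < Q)
    (h : ∀ (k : ℕ) (u v : EuclideanSpace 𝕜 (Fin d)),
      ‖wedge (lin (g ^ k) u) (lin (g ^ k) v)‖ ≤ Q ^ k * ‖wedge u v‖) :
    ell 1 g * ell 2 g ≤ Q := by
  obtain ⟨l, m, hlm, h1, h2, -⟩ := exists_roots_ell hd g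
  obtain ⟨x, y, a, hx0, hy0, hx, hy⟩ := exists_triangular_pair _ hlm
  rw [h1, h2, ← norm_mul]
  have hpow : ∀ k : ℕ, wedge (lin (complexify (g ^ k)) x) (lin (complexify (g ^ k)) y) =
      (l * m) ^ k • wedge x y := by
    intro k
    have hk : ∀ k : ℕ, ∃ b : ℂ, lin (complexify (g ^ k)) x = l ^ k • x ∧
        lin (complexify (g ^ k)) y = m ^ k • y + b • x := by
      intro k
      induction k with
      | zero => exact ⟨0, by simp [complexify, lin_one_apply]⟩
      | succ k ih =>
        obtain ⟨b, hb1, hb2⟩ := ih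
        have e : ∀ z, lin (complexify (g ^ (k + 1))) z =
            lin (complexify g) (lin (complexify (g ^ k)) z) := by
          intro z
          rw [← lin_mul_apply, pow_succ', complexify, complexify, complexify, map_mul]
        refine ⟨m ^ k * a + b * l, ?_, ?_⟩
        · rw [e, hb1, map_smul, hx, smul_smul, pow_succ]
        · rw [e, hb2, map_add, map_smul, map_smul, hx, hy]
          module
    obtain ⟨b, hb1, hb2⟩ := hk k
    rw [hb1, hb2]
    ext p
    simp
    ring
  obtain ⟨p, hp⟩ : ∃ p, wedge x y p ≠ 0 := by
    by_contra! h0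
    exact wedge_ne_zero hx0 hy0 (by ext p; simpa using h0 p)
  have hminor : ∀ (k : ℕ) (c e : Fin d),
      ‖(complexify (g ^ k) : Matrix (Fin d) (Fin d) ℂ) p.1 c *
        (complexify (g ^ k) : Matrix (Fin d) (Fin d) ℂ) p.2 e -
        (complexify (g ^ k) : Matrix (Fin d) (Fin d) ℂ) p.2 c *
        (complexify (g ^ k) : Matrix (Fin d) (Fin d) ℂ) p.1 e‖ ≤ Q ^ k * 2 := by
    intro k c e
    have hcol : ∀ a c : Fin d, lin (g ^ k) (EuclideanSpace.single c 1) a =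
        ((g ^ k : GL (Fin d) 𝕜) : Matrix (Fin d) (Fin d) 𝕜) a c := by
      intro a c; simp [lin_apply]
    simp only [complexify_val_apply]
    rw [← map_mul, ← map_mul, ← map_sub, norm_toComplex, ← hcol, ← hcol, ← hcol, ← hcol]
    refine (PiLp.norm_apply_le (wedge (lin (g ^ k) (EuclideanSpace.single c (1 : 𝕜)))
      (lin (g ^ k) (EuclideanSpace.single e 1))) p).trans ((h k _ _).trans ?_)
    gcongr
    refine (norm_wedge_le _ _).trans ?_
    simp
  have hp' := norm_pos_iff.2 hp
  refine le_of_forall_pow_le_mul_pow (C := d * (d * (2 * ‖wedge x y‖)) / (2 * ‖wedge x y p‖)) hQ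
    fun k => ?_
  rw [div_mul_eq_mul_div, le_div_iff₀ (by positivity)]
  have hsum := two_mul_wedge_lin_apply (complexify (g ^ k)) x y p
  rw [hpow] at hsum
  calc ‖l * m‖ ^ k * (2 * ‖wedge x y p‖) = ‖2 * ((l * m) ^ k • wedge x y) p‖ := by
        simp only [PiLp.smul_apply, smul_eq_mul, norm_mul, norm_pow, RCLike.norm_ofNat]
        ring
    _ ≤ ∑ _c : Fin d, ∑ _e : Fin d, Q ^ k * 2 * ‖wedge x y‖ := by
        rw [hsum]
        refine norm_sum_le_of_le _ fun c _ => norm_sum_le_of_le _ fun e _ => ?_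
        rw [norm_mul]
        gcongr
        · exact hminor k c e
        · exact PiLp.norm_apply_le (wedge x y) (c, e)
    _ = _ := by
        simp only [Finset.sum_const, Finset.card_univ, Fintype.card_fin, nsmul_eq_mul]
        ring

end Eigenvalues

/-! ### Estimates for reduced words -/

section Assembly

variable {𝕜 : Type*} [RCLike 𝕜] {d : ℕ}

theorem prod_sigma_pos (hd : 2 ≤ d) (w : List (GL (Fin d) 𝕜)) :
    0 < (w.map fun γ => sigma 1 γ).prod ∧ 0 < (w.map fun γ => sigma 1 γ * sigma 2 γ).prod := by
  refine ⟨List.prod_pos ?_, List.prod_pos ?_⟩ <;>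
  · intro a ha
    obtain ⟨γ, -, rfl⟩ := List.mem_map.1 ha
    have := sigma_pos hd (i := 1) (by norm_num) γ
    have := sigma_pos hd (i := 2) (by norm_num) γ
    positivity

theorem prod_gap_eq (hd : 2 ≤ d) (w : List (GL (Fin d) 𝕜)) :
    (w.map fun γ => sigma 1 γ / sigma 2 γ).prod =
      (w.map fun γ => sigma 1 γ).prod ^ 2 / (w.map fun γ => sigma 1 γ * sigma 2 γ).prod := by
  rw [eq_div_iff (prod_sigma_pos hd w).2.ne', ← List.prod_map_mul, sq, ← List.prod_map_mul]
  congr 1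
  refine List.map_congr_left fun γ _ => ?_
  have := sigma_pos hd (i := 2) (by norm_num) γ
  field_simp

/-- A ratio `s / t = s² / (s t)` is bounded below by a lower bound for `s` and an upper bound
for `s t`. -/
theorem sq_div_le_div {s t P Q : ℝ} (hP : 0 ≤ P) (hs : 0 < s) (ht : 0 < t)
    (hPs : P ≤ s) (hQ : s * t ≤ Q) : P ^ 2 / Q ≤ s / t := by
  calc P ^ 2 / Q ≤ s ^ 2 / (s * t) := by gcongr
    _ = s / t := by field_simp

variable {Γ : Fin 2 → Subsemigroup (GL (Fin d) 𝕜)}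
  {A B : Fin 2 → Set (EuclideanSpace 𝕜 (Fin d))} {ε δ : ℝ}

theorem IsConeSystem.le_sigma_one_prod (h : IsConeSystem Γ A B ε δ) (hd : 2 ≤ d) {i k : Fin 2}
    {w : List (GL (Fin d) 𝕜)} (hw : Alternating Γ i k w) :
    (δ * ε / (2 + δ)) ^ w.length * (w.map fun γ => sigma 1 γ).prod ≤ sigma 1 w.prod := by
  obtain ⟨x, hx, -⟩ := h.ball_left k
  exact le_of_mul_le_mul_right ((h.le_norm_lin_prod hd hw hx).trans (norm_lin_le _ x))
    (norm_pos_iff.2 (h.ne_zero_left k x hx))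

/-- An alternating word of even length maps a cone `A i` into itself, so that the expansion on `A i`
carries over to its powers. -/
theorem IsConeSystem.le_norm_lin_prod_pow (h : IsConeSystem Γ A B ε δ) (hd : 2 ≤ d) {i : Fin 2}
    {w : List (GL (Fin d) 𝕜)} (hw : Alternating Γ i i w) {x : EuclideanSpace 𝕜 (Fin d)}
    (hx : x ∈ A i) (n : ℕ) : lin (w.prod ^ n) x ∈ A i ∧
      ((δ * ε / (2 + δ)) ^ w.length * (w.map fun γ => sigma 1 γ).prod) ^ n * ‖x‖ ≤
        ‖lin (w.prod ^ n) x‖ := by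
  have hε := h.eps_pos
  have hδ := h.delta_pos
  have hP := (prod_sigma_pos hd w).1
  induction n with
  | zero => simpa [lin_one_apply] using hx
  | succ n ih =>
    rw [pow_succ' w.prod, lin_mul_apply]
    refine ⟨h.lin_prod_mem hw ih.1, le_trans ?_ (h.le_norm_lin_prod hd hw ih.1)⟩
    rw [pow_succ' (_ * _), mul_assoc]
    exact mul_le_mul_of_nonneg_left ih.2 (by positivity)

theorem norm_wedge_lin_prod_pow_le (w : List (GL (Fin d) 𝕜)) (n : ℕ)
    (x y : EuclideanSpace 𝕜 (Fin d)) :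
    ‖wedge (lin (w.prod ^ n) x) (lin (w.prod ^ n) y)‖ ≤
      (w.map fun γ => sigma 1 γ * sigma 2 γ).prod ^ n * ‖wedge x y‖ := by
  have := norm_wedge_lin_prod_le (List.replicate n w).flatten x y
  simpa [List.prod_flatten, List.map_flatten] using this

end Assembly

end PingPong

end

theorem theorem1p2 {𝕜 : Type*} [RCLike 𝕜] {d : ℕ} (hd : 2 ≤ d)
    (Γ : Fin 2 → Subsemigroup (GL (Fin d) 𝕜))
    (U : Fin 2 → Set (Projectivization 𝕜 (EuclideanSpace 𝕜 (Fin d))))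
    (V : Fin 2 → Set (PingPong.Hyperplane 𝕜 d))
    (hU : ∀ i, (U i).Nonempty) (hV : ∀ i, (V i).Nonempty)
    (hΓ : ∀ i, PingPong.IsDivergent 1 (Γ i))
    (hpp : PingPong.InPingPongPosition Γ U V) :
    (∃ C₁ : ℝ, ∃ lam : ℝ, 0 < C₁ ∧ 1 < lam ∧ ∀ w, PingPong.IsReducedWord Γ w →
      C₁ * lam ^ w.length ≤ PingPong.sigma 1 w.prod / PingPong.sigma 2 w.prod) ∧
    (∃ C₂ : ℝ, 0 < C₂ ∧ ∀ w, PingPong.IsReducedWord Γ w →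
      C₂ ^ w.length * (w.map fun γ => PingPong.sigma 1 γ).prod ≤ PingPong.sigma 1 w.prod) ∧
    (∃ C₃ : ℝ, 0 < C₃ ∧ ∀ w, PingPong.IsReducedWord Γ w →
      C₃ ^ w.length * (w.map fun γ => PingPong.sigma 1 γ / PingPong.sigma 2 γ).prod ≤
        PingPong.sigma 1 w.prod / PingPong.sigma 2 w.prod) ∧
    (∃ C₄ : ℝ, 0 < C₄ ∧ ∀ w, PingPong.IsReducedWord Γ w → Even w.length →
      C₄ ^ w.length * (w.map fun γ => PingPong.sigma 1 γ / PingPong.sigma 2 γ).prod ≤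
        PingPong.ell 1 w.prod / PingPong.ell 2 w.prod) := by
  obtain ⟨A, B, ε, δ, h⟩ := hpp.exists_isConeSystem hU hV
  have hε := h.eps_pos
  have hδ := h.delta_pos
  set c := δ * ε / (2 + δ) with hc
  have hc0 : 0 < c := by positivity
  refine ⟨?_, ⟨c, hc0, fun w hw => ?_⟩, ⟨c ^ 2 / 2, by positivity, fun w hw => ?_⟩,
    ⟨c ^ 2, by positivity, fun w hw hev => ?_⟩⟩
  · obtain ⟨C, lam, hC, hlam, hgrow⟩ := h.exists_gap_growth hd hΓ
    refine ⟨C, lam, hC, hlam, fun w hw => ?_⟩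
    obtain ⟨i, k, hw⟩ := hw.exists_alternating
    exact hgrow i k w hw
  · obtain ⟨i, k, hw⟩ := hw.exists_alternating
    exact h.le_sigma_one_prod hd hw
  · have hlen : w.length ≠ 0 := by have := hw.1; omega
    obtain ⟨i, k, hw⟩ := hw.exists_alternating
    obtain ⟨hP, hQ⟩ := PingPong.prod_sigma_pos hd w
    refine le_trans ?_ (PingPong.sq_div_le_div (by positivity)
      (PingPong.sigma_pos hd (by norm_num) _) (PingPong.sigma_pos hd (by norm_num) _)
      (h.le_sigma_one_prod hd hw) (PingPong.sigma_mul_sigma_prod_le hd w))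
    -- The factor `2` is absorbed in the constant because the word is not empty.
    have h2 : (1 / 2 : ℝ) ^ w.length ≤ 1 / 2 := pow_le_of_le_one (by norm_num) (by norm_num) hlen
    rw [PingPong.prod_gap_eq hd, ← hc]
    set P := (w.map fun γ => PingPong.sigma 1 γ).prod
    set Q := (w.map fun γ => PingPong.sigma 1 γ * PingPong.sigma 2 γ).prod
    calc (c ^ 2 / 2) ^ w.length * (P ^ 2 / Q)
        = (1 / 2) ^ w.length * ((c ^ w.length * P) ^ 2 / Q) := by
          rw [div_eq_mul_one_div (c ^ 2), mul_pow, pow_right_comm, mul_pow]; ring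
      _ ≤ 1 / 2 * ((c ^ w.length * P) ^ 2 / Q) := by gcongr
      _ = (c ^ w.length * P) ^ 2 / (2 * Q) := by field_simp
  · obtain ⟨i, k, hw⟩ := hw.exists_alternating
    obtain rfl := hw.even_length_iff.1 hev
    obtain ⟨hP, hQ⟩ := PingPong.prod_sigma_pos hd w
    obtain ⟨x, hx, -⟩ := h.ball_left i
    have h1 := PingPong.le_ell_one hd w.prod (by positivity) (h.ne_zero_left i x hx)
      fun n => (h.le_norm_lin_prod_pow hd hw hx n).2
    have h2 := PingPong.ell_mul_ell_le hd w.prod hQ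
      fun n u v => PingPong.norm_wedge_lin_prod_pow_le w n u v
    refine le_trans (le_of_eq ?_) (PingPong.sq_div_le_div (by positivity)
      (lt_of_lt_of_le (by positivity) h1) (PingPong.ell_two_pos hd _) h1 h2)
    rw [PingPong.prod_gap_eq hd, ← hc]
    ring
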